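/- Let $N\ge 2$ and $0<r_1<r_2<R$. Write $B_r=\{x\in\mathbb{R}^N: |x|<r\}$ and $S=S_{r_1,r_2}=B_{r_2}\setminus\overline{B_{r_1}}$. Let $W^{1,1}_0(B_R)$ be the closure of $C^\infty_0(B_R)$ in the Sobolev space $W^{1,1}(B_R)$, and let \[ \mathrm{cap}_1(\overline{B_{r_2}};B_R)=\inf\Big\{\int_{B_R}|\nabla\varphi|\,dx\,:\,\varphi\in C^\infty_0(B_R),\ \varphi\ge 1\text{ on }\overline{B_{r_2}}\Big\}. \] Then \[ \sup_{\varphi\in W^{1,1}_0(B_R)\setminus\{0\}}\frac{\int_{S}|\varphi|\,dx}{\int_{B_R}|\nabla\varphi|\,dx}=\frac{|S|}{\mathrm{cap}_1(\overline{B_{r_2}};B_R)}=\frac{|S|}{\mathcal{H}^{N-1}(\partial B_{r_2})}. \] Moreover, define the Cheeger-type constant \[ h=\inf\Big\{\frac{\mathcal{H}^{N-1}(\partial E)}{|E\cap S|}\,:\,E\Subset B_R\text{ open with smooth boundary}\Big\}, \] where the ratio is understood to be $+\infty$ if $|E\cap S|=0$. Then \[ \inf_{\varphi\in C^\infty_0(B_R)\setminus\{0\}}\frac{\int_{B_R}|\nabla\varphi|\,dx}{\int_S|\varphi|\,dx}=h=\frac{\mathrm{cap}_1(\overline{B_{r_2}};B_R)}{|S|}=\frac{\mathcal{H}^{N-1}(\partial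 B_{r_2})}{|S|} \] (the ratio in the first infimum being $+\infty$ when $\int_S|\varphi|\,dx=0$), and the infimum defining $h$ is attained at $E=B_{r_2}$. -/

import Mathlib

open MeasureTheory Set TopologicalSpace
open scoped ENNReal ContDiff Distributions

/-- `G` is a weak gradient of `u` in the open set `Ω`, tested in every direction `v`. -/
def IsWeakGradient {N : ℕ} (Ω : Opens (EuclideanSpace ℝ (Fin N)))
    (u : EuclideanSpace ℝ (Fin N) → ℝ)
    (G : EuclideanSpace ℝ (Fin N) → EuclideanSpace ℝ (Fin N)) : Prop :=
  ∀ (φ : 𝓓(Ω, ℝ)) (v : EuclideanSpace ℝ (Fin N)),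
    ∫ x in (Ω : Set (EuclideanSpace ℝ (Fin N))), u x * fderiv ℝ φ x v =
      -∫ x in (Ω : Set (EuclideanSpace ℝ (Fin N))), inner ℝ (G x) v * φ x

/-- `u ∈ W^{1,p}(Ω)`, with weak gradient `G`. -/
structure MemSobolev {N : ℕ} (p : ℝ≥0∞) (Ω : Opens (EuclideanSpace ℝ (Fin N)))
    (u : EuclideanSpace ℝ (Fin N) → ℝ)
    (G : EuclideanSpace ℝ (Fin N) → EuclideanSpace ℝ (Fin N)) : Prop where
  memLp : MemLp u p (volume.restrict (Ω : Set (EuclideanSpace ℝ (Fin N))))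
  memLp_grad : MemLp G p (volume.restrict (Ω : Set (EuclideanSpace ℝ (Fin N))))
  isWeakGradient : IsWeakGradient Ω u G

/-- `u ∈ W^{1,p}_0(Ω)`, with weak gradient `G`: `u` belongs to the closure of `C_c^∞(Ω)` in
`W^{1,p}(Ω)`. -/
structure MemSobolevZero {N : ℕ} (p : ℝ≥0∞) (Ω : Opens (EuclideanSpace ℝ (Fin N)))
    (u : EuclideanSpace ℝ (Fin N) → ℝ)
    (G : EuclideanSpace ℝ (Fin N) → EuclideanSpace ℝ (Fin N)) : Prop extends
    MemSobolev p Ω u G where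
  mem_closure : ∀ ε : ℝ≥0∞, 0 < ε → ∃ φ : 𝓓(Ω, ℝ),
    eLpNorm (fun x => u x - φ x) p (volume.restrict (Ω : Set (EuclideanSpace ℝ (Fin N)))) +
      eLpNorm (fun x => G x - gradient φ x) p
        (volume.restrict (Ω : Set (EuclideanSpace ℝ (Fin N)))) < ε

/-- The `p`-capacity of `K` relative to the open set `Ω`. -/
noncomputable def relCapacity {N : ℕ} (p : ℝ) (K : Set (EuclideanSpace ℝ (Fin N)))
    (Ω : Opens (EuclideanSpace ℝ (Fin N))) : ℝ≥0∞ :=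
  ⨅ (φ : 𝓓(Ω, ℝ)) (_ : ∀ x ∈ K, 1 ≤ φ x),
    ∫⁻ x in (Ω : Set (EuclideanSpace ℝ (Fin N))), ‖gradient φ x‖ₑ ^ p

/-- The ball `B_R` centred at the origin, as an open set. -/
def centredBall (N : ℕ) (R : ℝ) : Opens (EuclideanSpace ℝ (Fin N)) :=
  ⟨Metric.ball 0 R, Metric.isOpen_ball⟩

/-- The spherical shell `S_{r₁,r₂} = {x : r₁ < |x| < r₂}`. -/
def shell (N : ℕ) (r₁ r₂ : ℝ) : Set (EuclideanSpace ℝ (Fin N)) :=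
  Metric.ball 0 r₂ \ Metric.closedBall 0 r₁

/-- The supremum of `∫_S |u| / ∫_Ω |∇u|` over the nonzero elements `u` of `W^{1,1}_0(Ω)`. -/
noncomputable def sharpConstant {N : ℕ} (Ω : Opens (EuclideanSpace ℝ (Fin N)))
    (S : Set (EuclideanSpace ℝ (Fin N))) : ℝ≥0∞ :=
  ⨆ (u : EuclideanSpace ℝ (Fin N) → ℝ)
    (G : EuclideanSpace ℝ (Fin N) → EuclideanSpace ℝ (Fin N))
    (_ : MemSobolevZero 1 Ω u G)
    (_ : ¬ u =ᵐ[volume.restrict (Ω : Set (EuclideanSpace ℝ (Fin N)))] 0),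
    (∫⁻ x in S, ‖u x‖ₑ) / ∫⁻ x in (Ω : Set (EuclideanSpace ℝ (Fin N))), ‖G x‖ₑ

/-- An open set with smooth boundary: near each boundary point it is the strict sublevel set of
a smooth function with nonvanishing differential. -/
def IsOpenSmoothBoundary {N : ℕ} (E : Set (EuclideanSpace ℝ (Fin N))) : Prop :=
  IsOpen E ∧ ∀ x ∈ frontier E, ∃ U : Set (EuclideanSpace ℝ (Fin N)), IsOpen U ∧ x ∈ U ∧
    ∃ f : EuclideanSpace ℝ (Fin N) → ℝ, ContDiffOn ℝ ∞ f U ∧ f x = 0 ∧ fderiv ℝ f x ≠ 0 ∧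
      E ∩ U = {y ∈ U | f y < 0}

/-- The open sets with smooth boundary that are compactly contained in `Ω`. -/
def IsCheegerAdmissible {N : ℕ} (Ω : Opens (EuclideanSpace ℝ (Fin N)))
    (E : Set (EuclideanSpace ℝ (Fin N))) : Prop :=
  IsOpenSmoothBoundary E ∧ IsCompact (closure E) ∧
    closure E ⊆ (Ω : Set (EuclideanSpace ℝ (Fin N)))

open Classical in
/-- The ratio `H^{N-1}(∂E) / |E ∩ S|`, equal to `+∞` when `|E ∩ S| = 0`. Here `μHE[d]` is the
`d`-dimensional Hausdorff measure normalized to agree with Lebesgue measure on `ℝ^d`. -/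
noncomputable def cheegerRatio {N : ℕ} (S E : Set (EuclideanSpace ℝ (Fin N))) : ℝ≥0∞ :=
  if volume (E ∩ S) = 0 then ⊤ else μHE[N - 1] (frontier E) / volume (E ∩ S)

/-- The Cheeger-type constant of `Ω` relative to `S`. -/
noncomputable def cheegerConstant {N : ℕ} (Ω : Opens (EuclideanSpace ℝ (Fin N)))
    (S : Set (EuclideanSpace ℝ (Fin N))) : ℝ≥0∞ :=
  ⨅ (E : Set (EuclideanSpace ℝ (Fin N))) (_ : IsCheegerAdmissible Ω E), cheegerRatio S E

/-! Write N = n + 1 and C = (r₂^(n+1) - r₁^(n+1)) / ((n+1) r₂^n), which equals |S| / H^n(∂B_{r₂}).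
Both halves of the theorem rest on looking outward along rays from the origin. An area element at
distance ρ, facing the origin, shadows within S a volume at most (min(r₂, ρ)^(n+1) - r₁^(n+1)) /
((n+1) ρ^n) per unit area, and this is largest at ρ = r₂, with value C (`min_pow_sub_pow_div_le`).

For functions, |φ(rθ)| is at most the integral of |∇φ| along the ray beyond r. Polar coordinates and
Tonelli turn this into ∫_S |φ| ≤ C ∫ |∇φ| (`lintegral_shell_enorm_le`), which passes to W₀^{1,1} by
density. Radial cutoffs falling from 1 to 0 just outside B_{r₂} show that the capacity is at most
H^n(∂B_{r₂}); the inequality gives the converse, and capacity competitors show that C is sharp.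

For sets, every ray from a point of E ∩ S meets ∂E, so E ∩ S lies in the shadow of ∂E. Locally ∂E is
projected centrally to a hyperplane, with Lipschitz constant close to 1, and its shadow lies in a
flat cone whose volume is explicit. Countable gluing yields |E ∩ S| ≤ C H^n(∂E)
(`volume_inter_shell_le`), with equality for E = B_{r₂}.

The Hausdorff area of spheres is obtained by the same cone comparison
(`euclideanHausdorffMeasure_sphere`). -/

/-! ### Comparison of set functions from local estimates -/

section LocalComparison

variable {X : Type*} [TopologicalSpace X] [SecondCountableTopology X] [MeasurableSpace X]
  [OpensMeasurableSpace X]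

/-- A local domination of an outer measure by a multiple of a measure is a global one. -/
theorem MeasureTheory.OuterMeasure.le_mul_of_locally_le (τ : OuterMeasure X) (ν : Measure X)
    (c : ℝ≥0∞)
    (h : ∀ x, ∃ U ∈ nhds x, ∀ A ⊆ U, MeasurableSet A → τ A ≤ c * ν A)
    {A : Set X} (hA : MeasurableSet A) : τ A ≤ c * ν A := by
  choose U hU hle using h
  have hU' : ∀ x, interior (U x) ∈ nhds x := fun x => interior_mem_nhds.2 (hU x)
  obtain ⟨s, hs, hcov⟩ := TopologicalSpace.countable_cover_nhds hU'
  rcases s.eq_empty_or_nonempty with rfl | hne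
  · have hA0 : A = ∅ := by
      have : (univ : Set X) = ∅ := by simpa using hcov.symm
      exact eq_empty_of_subset_empty (this ▸ subset_univ A)
    simp [hA0]
  obtain ⟨e, rfl⟩ := hs.exists_eq_range hne
  let V : ℕ → Set X := fun i => interior (U (e i))
  have hV : ⋃ i, V i = univ := by simpa [V, biUnion_range] using hcov
  -- Disjoint pieces are needed because τ is only subadditive, while the values of ν have to add up
  -- to exactly ν A.
  let P : ℕ → Set X := fun i => A ∩ disjointed V i
  have hPm : ∀ i, MeasurableSet (P i) := fun i =>
    hA.inter (MeasurableSet.disjointed (fun j => isOpen_interior.measurableSet) i)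
  have hPU : ⋃ i, P i = A := by
    rw [← inter_iUnion, iUnion_disjointed, hV, inter_univ]
  have hPd : Pairwise (Function.onFun Disjoint P) := fun i j hij =>
    (disjoint_disjointed V hij).mono inter_subset_right inter_subset_right
  calc τ A = τ (⋃ i, P i) := by rw [hPU]
    _ ≤ ∑' i, τ (P i) := measure_iUnion_le _
    _ ≤ ∑' i, c * ν (P i) := ENNReal.tsum_le_tsum fun i =>
        hle (e i) _ (inter_subset_right.trans ((disjointed_subset _ _).trans interior_subset))
          (hPm i)
    _ = c * ν A := by rw [ENNReal.tsum_mul_left, ← measure_iUnion hPd hPm, hPU]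

end LocalComparison

/-! ### Lipschitz maps and central projection -/

theorem LipschitzOnWith.euclideanHausdorffMeasure_image_le {X Y : Type*} [EMetricSpace X]
    [MeasurableSpace X] [BorelSpace X] [EMetricSpace Y] [MeasurableSpace Y] [BorelSpace Y]
    {K : NNReal} {f : X → Y} {s : Set X} (h : LipschitzOnWith K f s) (d : ℕ) :
    μHE[d] (f '' s) ≤ (K : ℝ≥0∞) ^ d * μHE[d] s := by
  simp only [Measure.euclideanHausdorffMeasure_def, Measure.smul_apply, ENNReal.smul_def,
    smul_eq_mul]
  rw [mul_left_comm]
  gcongr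
  simpa using h.hausdorffMeasure_image_le (Nat.cast_nonneg d)

/-- Near `ρ • u`, the central projection to the hyperplane `⟪u, x⟫ = ρ` is almost `1`-Lipschitz. -/
theorem exists_lipschitzOnWith_centralProjection {E : Type*} [NormedAddCommGroup E]
    [InnerProductSpace ℝ E] {u : E} (hu : ‖u‖ = 1) {ρ : ℝ} (hρ : 0 < ρ)
    {K : NNReal} (hK : 1 < K) :
    ∃ s ∈ nhds (ρ • u), LipschitzOnWith K (fun x : E => (ρ / inner ℝ u x) • x) s := by
  have hval : inner ℝ u (ρ • u) = ρ := by simp [inner_smul_right, hu]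
  have h1 : HasStrictFDerivAt (fun x : E => inner ℝ u x) (innerSL ℝ u) (ρ • u) :=
    (innerSL ℝ u).hasStrictFDerivAt
  have h2 : HasStrictDerivAt (fun t : ℝ => ρ / t) (-ρ⁻¹) (inner ℝ u (ρ • u)) := by
    rw [hval]
    have := (hasStrictDerivAt_inv hρ.ne').const_mul ρ
    simp only [← div_eq_mul_inv] at this
    have e : ρ * -(ρ ^ 2)⁻¹ = -ρ⁻¹ := by field_simp
    exact e ▸ this
  have h3 := (h2.comp_hasStrictFDerivAt (ρ • u) h1).smul (hasStrictFDerivAt_id (ρ • u))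
  refine h3.exists_lipschitzOnWith_of_nnnorm_lt K (lt_of_le_of_lt ?_ hK)
  rw [← NNReal.coe_le_coe, coe_nnnorm, NNReal.coe_one]
  refine ContinuousLinearMap.opNorm_le_bound _ zero_le_one fun v => ?_
  -- The derivative at ρ • u is the orthogonal projection onto the complement of u, hence of norm at
  -- most 1; strict differentiability gives any Lipschitz constant K > 1 nearby.
  have : (((ρ / inner ℝ u (ρ • u)) • ContinuousLinearMap.id ℝ E +
      ((-ρ⁻¹) • innerSL ℝ u).smulRight (id (ρ • u))) v) = v - (inner ℝ u v : ℝ) • u := by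
    simp only [hval, id]
    simp [smul_smul, hρ.ne', sub_eq_add_neg, mul_right_comm]
  refine (congrArg norm this).trans_le ?_
  rw [one_mul]
  refine abs_le_of_sq_le_sq' ?_ (norm_nonneg v) |>.2
  rw [norm_sub_sq_real, inner_smul_right, norm_smul, hu, real_inner_comm]
  simp
  nlinarith [sq_nonneg (inner ℝ u v : ℝ)]

/-! ### Volume of cones over flat pieces -/

section Cone

open scoped Pointwise

variable {E : Type*} [NormedAddCommGroup E] [InnerProductSpace ℝ E] [FiniteDimensional ℝ E]
  [MeasurableSpace E] [BorelSpace E]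

/-- The part of the cone over `D`, a subset of the hyperplane `⟪u, x⟫ = ρ`, that lies between the
hyperplanes at levels `α` and `β`. -/
def coneSlab (u : E) (ρ α β : ℝ) (D : Set E) : Set E :=
  {x | α < inner ℝ u x ∧ inner ℝ u x < β ∧ (ρ / inner ℝ u x) • x ∈ D}

theorem measurableSet_coneSlab (u : E) (ρ α β : ℝ) {D : Set E} (hD : MeasurableSet D) :
    MeasurableSet (coneSlab u ρ α β D) := by
  have h1 : Measurable fun x : E => inner ℝ u x := by fun_prop
  refine (measurableSet_lt measurable_const h1).inter
    ((measurableSet_lt h1 measurable_const).inter (?_ : MeasurableSet _))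
  exact ((measurable_const.div h1).smul measurable_id) hD

theorem lintegral_Ioo_div_pow (n : ℕ) {ρ α β : ℝ} (hρ : 0 < ρ) (hα : 0 ≤ α) (hβ : 0 ≤ β) :
    ∫⁻ t in Ioo α β, ENNReal.ofReal ((t / ρ) ^ n) =
      ENNReal.ofReal ((β ^ (n + 1) - α ^ (n + 1)) / ((n + 1) * ρ ^ n)) := by
  rcases le_total β α with h | h
  -- Both sides vanish, the right one by truncation in `ENNReal.ofReal`. This case occurs for
  -- screens lying inside B_{r₁}.
  · rw [Ioo_eq_empty (not_lt.2 h), Measure.restrict_empty, lintegral_zero_measure,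
      ENNReal.ofReal_of_nonpos]
    have : β ^ (n + 1) ≤ α ^ (n + 1) := pow_le_pow_left₀ hβ h _
    exact div_nonpos_of_nonpos_of_nonneg (by linarith) (by positivity)
  · rw [Measure.restrict_congr_set Ioo_ae_eq_Ioc, ← ofReal_integral_eq_lintegral_ofReal,
      ← intervalIntegral.integral_of_le h]
    · congr 1
      simp only [div_pow]
      rw [intervalIntegral.integral_div, integral_pow]
      field_simp
    · exact (Continuous.intervalIntegrable (by fun_prop) α β).1
    · filter_upwards [ae_restrict_mem measurableSet_Ioc] with t ht
      have : 0 < t := hα.trans_lt ht.1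
      positivity

/-- Cavalieri's principle: the slice at height t is the dilate (t/ρ) • D, of area (t/ρ)^n times that
of D. -/
theorem volume_coneSlab {n : ℕ} (hn : Module.finrank ℝ E = n + 1) {u : E} (hu : ‖u‖ = 1)
    {ρ α β : ℝ} (hρ : 0 < ρ) (hα : 0 ≤ α) (hβ : 0 ≤ β) {D : Set E} (hD : MeasurableSet D)
    (hDu : ∀ z ∈ D, inner ℝ u z = ρ) :
    volume (coneSlab u ρ α β D) =
      ENNReal.ofReal ((β ^ (n + 1) - α ^ (n + 1)) / ((n + 1) * ρ ^ n)) * μHE[n] D := by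
  have hu0 : u ≠ 0 := by rintro rfl; simp at hu
  have key := EuclideanGeometry.euclideanHausdorffMeasure_eq_lintegral (0 : E) hu0
    (measurableSet_coneSlab u ρ α β hD)
  rw [InnerProductSpace.euclideanHausdorffMeasure_eq_volume] at key
  rw [key, hn, Nat.add_sub_cancel, ← lintegral_Ioo_div_pow n hρ hα hβ, ← lintegral_mul_const'' _
    (by fun_prop), ← lintegral_indicator measurableSet_Ioo, enorm_eq_nnnorm,
    show ‖u‖₊ = 1 from NNReal.eq hu, ENNReal.coe_one, one_mul]
  refine lintegral_congr fun t => ?_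
  have hmem : ∀ x : E, x ∈ (AffineSubspace.mk' (t • u +ᵥ (0 : E)) (Submodule.span ℝ {u})ᗮ : Set E) ↔
      inner ℝ u x = t := by
    intro x
    rw [SetLike.mem_coe, AffineSubspace.mem_mk', Submodule.mem_orthogonal_singleton_iff_inner_right]
    simp [inner_sub_right, inner_smul_right, hu, sub_eq_zero]
  by_cases ht : t ∈ Ioo α β
  · rw [indicator_of_mem ht]
    have ht0 : 0 < t := hα.trans_lt ht.1
    have hc : t / ρ ≠ 0 := by positivity
    have : coneSlab u ρ α β D ∩ (AffineSubspace.mk' (t • u +ᵥ (0 : E)) (Submodule.span ℝ {u})ᗮ : Set E)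
        = (t / ρ) • D := by
      ext x
      rw [mem_inter_iff, hmem, mem_smul_set_iff_inv_smul_mem₀ hc, inv_div]
      constructor
      · rintro ⟨⟨_, _, h⟩, rfl⟩
        exact h
      · intro h
        have h1 := hDu _ h
        rw [inner_smul_right] at h1
        have h2 : inner ℝ u x = t := by field_simp at h1; linarith
        exact ⟨⟨by rw [h2]; exact ht.1, by rw [h2]; exact ht.2, by rwa [h2]⟩, h2⟩
    rw [this, Measure.euclideanHausdorffMeasure_smul₀ n hc, ENNReal.smul_def, smul_eq_mul]
    congr 1
    rw [ENNReal.ofReal, ENNReal.coe_inj]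
    apply NNReal.eq
    rw [Real.coe_toNNReal _ (by positivity)]
    simp [abs_of_pos ht0, abs_of_pos hρ]
  · rw [indicator_of_notMem ht]
    have : coneSlab u ρ α β D ∩ (AffineSubspace.mk' (t • u +ᵥ (0 : E)) (Submodule.span ℝ {u})ᗮ : Set E)
        = ∅ := by
      ext x
      rw [mem_inter_iff, hmem]
      simp only [mem_empty_iff_false, iff_false]
      rintro ⟨⟨h1, h2, _⟩, rfl⟩
      exact ht ⟨h1, h2⟩
    rw [this, measure_empty]

/-- Used for D the projection of an arbitrary set, which need not be measurable; a measurable hull,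
cut down to the hyperplane, replaces D. -/
theorem volume_coneSlab_le {n : ℕ} (hn : Module.finrank ℝ E = n + 1) {u : E} (hu : ‖u‖ = 1)
    {ρ α β : ℝ} (hρ : 0 < ρ) (hα : 0 ≤ α) (hβ : 0 ≤ β) {D : Set E}
    (hDu : ∀ z ∈ D, inner ℝ u z = ρ) :
    volume (coneSlab u ρ α β D) ≤
      ENNReal.ofReal ((β ^ (n + 1) - α ^ (n + 1)) / ((n + 1) * ρ ^ n)) * μHE[n] D := by
  let D' : Set E := toMeasurable (μHE[n] : Measure E) D ∩ {z | inner ℝ u z = ρ}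
  have hD' : MeasurableSet D' := (measurableSet_toMeasurable _ _).inter
    (isClosed_eq (by fun_prop) continuous_const).measurableSet
  have hsub : D ⊆ D' := fun z hz => ⟨subset_toMeasurable _ _ hz, hDu z hz⟩
  calc volume (coneSlab u ρ α β D) ≤ volume (coneSlab u ρ α β D') :=
        measure_mono fun x hx => ⟨hx.1, hx.2.1, hsub hx.2.2⟩
    _ = _ := volume_coneSlab hn hu hρ hα hβ hD' fun z hz => hz.2
    _ ≤ ENNReal.ofReal ((β ^ (n + 1) - α ^ (n + 1)) / ((n + 1) * ρ ^ n)) * μHE[n] D := by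
        refine mul_le_mul' le_rfl ?_
        exact (measure_mono (μ := (μHE[n] : Measure E)) inter_subset_left).trans_eq
          (measure_toMeasurable D)

end Cone

/-! ### Shadows and the relative isoperimetric inequality -/

section RadialShadow

variable {E : Type*} [NormedAddCommGroup E] [InnerProductSpace ℝ E]

/-- The points of `S` that lie on a segment from the origin to a point of `A`. -/
def radialShadow (S A : Set E) : Set E :=
  {x | x ∈ S ∧ ∃ y ∈ A, ∃ s ∈ Icc (0 : ℝ) 1, x = s • y}

/-- The volume of the radial shadow, as an outer measure. -/
noncomputable def radialShadowOuterMeasure [MeasurableSpace E] (μ : Measure E) (S : Set E) :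
    OuterMeasure E where
  measureOf A := μ (radialShadow S A)
  empty := by simp [radialShadow]
  mono {A B} h := measure_mono fun x ⟨hx, y, hy, hs⟩ => ⟨hx, y, h hy, hs⟩
  iUnion_nat A _ := by
    refine (measure_mono ?_).trans (measure_iUnion_le _)
    rintro x ⟨hx, y, hy, hs⟩
    obtain ⟨i, hi⟩ := mem_iUnion.1 hy
    exact mem_iUnion.2 ⟨i, hx, y, hi, hs⟩

/-- The ray {t • x : t ≥ 1} is connected and starts in U. If it missed the frontier it would stay in
U, against boundedness. -/
theorem inter_subset_radialShadow_frontier {S U : Set E} (hU : IsOpen U)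
    (hb : Bornology.IsBounded U) (hS : (0 : E) ∉ S) : U ∩ S ⊆ radialShadow S (frontier U) := by
  rintro x ⟨hxU, hxS⟩
  have hx0 : x ≠ 0 := fun h => hS (h ▸ hxS)
  let ray : Set E := (fun t : ℝ => t • x) '' Ici 1
  have hray : IsPreconnected ray := isPreconnected_Ici.image _ (by fun_prop)
  have hxray : x ∈ ray := ⟨1, by simp, by simp⟩
  by_contra hcon
  have hcov : ray ⊆ U ∪ (closure U)ᶜ := by
    rintro z ⟨t, ht, rfl⟩
    have ht : 1 ≤ t := ht
    have ht0 : t ≠ 0 := by positivity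
    by_contra hz
    simp only [mem_union, mem_compl_iff, not_or, not_not] at hz
    refine hcon ⟨hxS, t • x, ⟨hz.2, by rw [hU.interior_eq]; exact hz.1⟩, t⁻¹,
      ⟨by positivity, inv_le_one_of_one_le₀ ht⟩, ?_⟩
    simp [smul_smul, ht0]
  have hsub : ray ⊆ U := hray.subset_left_of_subset_union hU isClosed_closure.isOpen_compl
    (disjoint_compl_right.mono_left subset_closure) hcov ⟨x, hxray, hxU⟩
  obtain ⟨M, hM⟩ := hb.exists_norm_le
  have hM0 : 0 ≤ M := (norm_nonneg x).trans (hM x hxU)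
  have hxn : 0 < ‖x‖ := norm_pos_iff.2 hx0
  -- This point of the ray has norm ‖x‖ + M, which exceeds the bound M.
  have := hM _ (hsub ⟨1 + M / ‖x‖, by simp; positivity, rfl⟩)
  rw [norm_smul, Real.norm_of_nonneg (by positivity)] at this
  field_simp at this
  nlinarith

/-- The flux bound: the maximal ratio of the volume of a shadow to the area of the screen. -/
theorem min_pow_sub_pow_div_le (n : ℕ) {r₁ r₂ ρ : ℝ} (hr₁ : 0 < r₁) (hr₁₂ : r₁ < r₂)
    (hρ : 0 < ρ) :
    ((min r₂ ρ) ^ (n + 1) - r₁ ^ (n + 1)) / ((n + 1) * ρ ^ n) ≤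
      (r₂ ^ (n + 1) - r₁ ^ (n + 1)) / ((n + 1) * r₂ ^ n) := by
  have hr₂ : 0 < r₂ := hr₁.trans hr₁₂
  rw [div_le_div_iff₀ (by positivity) (by positivity)]
  -- In ρ, the left side decreases beyond r₂ (constant numerator) and increases before it, being
  -- ρ/(n+1) minus a multiple of ρ^(-n).
  rcases le_total r₂ ρ with h | h
  · rw [min_eq_left h]
    have h1 : r₂ ^ n ≤ ρ ^ n := pow_le_pow_left₀ hr₂.le h n
    have h2 : r₁ ^ (n + 1) ≤ r₂ ^ (n + 1) := pow_le_pow_left₀ hr₁.le hr₁₂.le _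
    have h3 : (0 : ℝ) ≤ r₂ ^ (n + 1) - r₁ ^ (n + 1) := by linarith
    gcongr
  · rw [min_eq_right h]
    have h1 : ρ ^ n ≤ r₂ ^ n := pow_le_pow_left₀ hρ.le h n
    have h2 : 0 < r₁ ^ (n + 1) := by positivity
    have h3 : 0 < ρ ^ n * r₂ ^ n := by positivity
    have key : (ρ ^ (n + 1) - r₁ ^ (n + 1)) * r₂ ^ n ≤ (r₂ ^ (n + 1) - r₁ ^ (n + 1)) * ρ ^ n := by
      simp only [pow_succ] at *
      nlinarith [mul_le_mul_of_nonneg_left h h3.le, mul_le_mul_of_nonneg_left h1 h2.le]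
    calc (ρ ^ (n + 1) - r₁ ^ (n + 1)) * ((n + 1) * r₂ ^ n)
        = (n + 1) * ((ρ ^ (n + 1) - r₁ ^ (n + 1)) * r₂ ^ n) := by ring
      _ ≤ (n + 1) * ((r₂ ^ (n + 1) - r₁ ^ (n + 1)) * ρ ^ n) := by gcongr
      _ = _ := by ring

variable [FiniteDimensional ℝ E] [MeasurableSpace E] [BorelSpace E]

/-- Near y₀ = ρ • u, the shadow of A lies in a cone over the central projection of A to ⟪u, x⟫ = ρ.
The errors in the two levels and in the Lipschitz constant are absorbed by the gap between c and the
flux bound. -/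
theorem exists_nhds_volume_radialShadow_le {n : ℕ} (hn : Module.finrank ℝ E = n + 1)
    {r₁ r₂ : ℝ} (hr₁ : 0 < r₁) (hr₁₂ : r₁ < r₂) {c : ℝ}
    (hc : (r₂ ^ (n + 1) - r₁ ^ (n + 1)) / ((n + 1) * r₂ ^ n) < c) (y₀ : E) :
    ∃ U ∈ nhds y₀, ∀ A ⊆ U,
      volume (radialShadow (Metric.ball 0 r₂ \ Metric.closedBall 0 r₁) A) ≤
        ENNReal.ofReal c * μHE[n] A := by
  -- Points of B_{r₁} cast no shadow on the shell, so the origin, where u is undefined, is harmless.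
  rcases eq_or_ne y₀ 0 with rfl | hy₀
  · refine ⟨Metric.ball 0 r₁, Metric.ball_mem_nhds 0 hr₁, fun A hA => ?_⟩
    have : radialShadow (Metric.ball 0 r₂ \ Metric.closedBall 0 r₁) A = ∅ := by
      ext x
      simp only [mem_empty_iff_false, iff_false]
      rintro ⟨⟨_, hx⟩, y, hy, s, hs, rfl⟩
      have h1 : ‖y‖ < r₁ := by simpa using hA hy
      simp only [Metric.mem_closedBall, dist_zero_right, not_le, norm_smul,
        Real.norm_of_nonneg hs.1] at hx
      nlinarith [hs.2, norm_nonneg y]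
    rw [this, measure_empty]
    exact zero_le
  set ρ : ℝ := ‖y₀‖ with hρdef
  have hρ : 0 < ρ := norm_pos_iff.2 hy₀
  set u : E := ρ⁻¹ • y₀ with hudef
  have hu : ‖u‖ = 1 := by simp [hudef, norm_smul, hρdef, hy₀]
  have hyu : y₀ = ρ • u := by simp [hudef, smul_smul, hρ.ne']
  have huu : inner ℝ u u = 1 := by simp [hu]
  have hr₂ : 0 < r₂ := hr₁.trans hr₁₂
  -- A single parameter η controls the upper level ρ + η, the lower level (1 - η) r₁ and the
  -- Lipschitz constant 1 + η.
  have hlim : Filter.Tendsto (fun η : ℝ => ((min r₂ (ρ + η)) ^ (n + 1) -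
      ((1 - η) * r₁) ^ (n + 1)) / ((n + 1) * ρ ^ n) * (1 + η) ^ n) (nhdsWithin 0 (Ioi 0))
      (nhds (((min r₂ ρ) ^ (n + 1) - r₁ ^ (n + 1)) / ((n + 1) * ρ ^ n))) := by
    have : Continuous (fun η : ℝ => ((min r₂ (ρ + η)) ^ (n + 1) -
      ((1 - η) * r₁) ^ (n + 1)) / ((n + 1) * ρ ^ n) * (1 + η) ^ n) := by fun_prop
    simpa using (this.tendsto 0).mono_left nhdsWithin_le_nhds
  have hev := hlim.eventually (gt_mem_nhds ((min_pow_sub_pow_div_le n hr₁ hr₁₂ hρ).trans_lt hc))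
  obtain ⟨η, hηlt, hη⟩ := (hev.and (Ioo_mem_nhdsGT (show (0 : ℝ) < 1 by norm_num))).exists
  obtain ⟨s, hs, hLip⟩ := exists_lipschitzOnWith_centralProjection hu hρ
    (K := (1 + η).toNNReal) (by
      rw [← NNReal.coe_lt_coe, Real.coe_toNNReal _ (by linarith [hη.1])]
      simpa using hη.1)
  have hnear : ∀ᶠ y in nhds y₀, inner ℝ u y < ρ + η ∧ (1 - η) * ‖y‖ < inner ℝ u y := by
    have hval : inner ℝ u y₀ = ρ := by
      rw [hyu, inner_smul_right, huu, mul_one]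
    have h1 : Continuous fun y : E => (inner ℝ u y : ℝ) := by fun_prop
    refine (h1.tendsto y₀ |>.eventually_lt_const (by rw [hval]; linarith [hη.1])).and ?_
    have h2 : Continuous fun y : E => (1 - η) * ‖y‖ := by fun_prop
    refine (h2.tendsto y₀).eventually_lt (h1.tendsto y₀) ?_
    rw [hval]
    nlinarith [hη.1]
  rw [← hyu] at hs
  refine ⟨s ∩ _, Filter.inter_mem hs hnear, fun A hA => ?_⟩
  set p : E → E := fun x => (ρ / inner ℝ u x) • x with hp
  have hA0 : ∀ y ∈ A, 0 < inner ℝ u y := fun y hy =>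
    lt_of_le_of_lt (by have := hη.2; have := norm_nonneg y; nlinarith) (hA hy).2.2
  have hsub : radialShadow (Metric.ball 0 r₂ \ Metric.closedBall 0 r₁) A ⊆
      coneSlab u ρ ((1 - η) * r₁) (min r₂ (ρ + η)) (p '' A) := by
    rintro x ⟨⟨hx2, hx1⟩, y, hy, t, ht, rfl⟩
    simp only [Metric.mem_ball, Metric.mem_closedBall, dist_zero_right, not_le] at hx1 hx2
    have hy0 := hA0 y hy
    have ht0 : 0 < t := by
      rcases ht.1.eq_or_lt with h | h
      · rw [← h] at hx1
        simp at hx1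
        linarith
      · exact h
    have hlow : (1 - η) * ‖y‖ < inner ℝ u y := (hA hy).2.2
    have hup : inner ℝ u y < ρ + η := (hA hy).2.1
    refine ⟨?_, lt_min ?_ ?_, y, hy, ?_⟩
    · rw [inner_smul_right]
      rw [norm_smul, Real.norm_of_nonneg ht0.le] at hx1
      calc (1 - η) * r₁ < (1 - η) * (t * ‖y‖) := by
            have : 0 < 1 - η := by linarith [hη.2]
            gcongr
        _ = t * ((1 - η) * ‖y‖) := by ring
        _ ≤ t * inner ℝ u y := by gcongr
    · exact lt_of_le_of_lt ((real_inner_le_norm _ _).trans (by rw [hu, one_mul])) hx2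
    · rw [inner_smul_right]
      nlinarith [ht.2]
    · simp only [hp, inner_smul_right, smul_smul]
      congr 1
      field_simp
  have hDu : ∀ z ∈ p '' A, inner ℝ u z = ρ := by
    rintro z ⟨y, hy, rfl⟩
    have := hA0 y hy
    simp only [hp, inner_smul_right]
    field_simp
  have hη1 : 0 ≤ 1 - η := by linarith [hη.2]
  have hη0 : 0 ≤ 1 + η := by linarith [hη.1]
  have hβ : 0 ≤ min r₂ (ρ + η) := le_min hr₂.le (by linarith [hη.1])
  calc volume (radialShadow (Metric.ball 0 r₂ \ Metric.closedBall 0 r₁) A)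
      ≤ _ := measure_mono hsub
    _ ≤ _ := volume_coneSlab_le hn hu hρ (by positivity) hβ hDu
    _ ≤ ENNReal.ofReal (((min r₂ (ρ + η)) ^ (n + 1) -
      ((1 - η) * r₁) ^ (n + 1)) / ((n + 1) * ρ ^ n)) *
        (((1 + η).toNNReal : ℝ≥0∞) ^ n * μHE[n] A) := by
        refine mul_le_mul' le_rfl ?_
        exact (hLip.mono fun y hy => (hA hy).1).euclideanHausdorffMeasure_image_le n
    _ = ENNReal.ofReal (((min r₂ (ρ + η)) ^ (n + 1) -
      ((1 - η) * r₁) ^ (n + 1)) / ((n + 1) * ρ ^ n) * (1 + η) ^ n) * μHE[n] A := by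
        rw [ENNReal.ofReal_mul' (by positivity), mul_assoc, ENNReal.ofReal_pow hη0]
        rfl
    _ ≤ _ := by
        refine mul_le_mul' (ENNReal.ofReal_le_ofReal hηlt.le) le_rfl

/-- A bounded open set meets the shell in volume at most `C` times the area of its boundary. -/
theorem volume_inter_shell_le {n : ℕ} (hn : Module.finrank ℝ E = n + 1)
    {r₁ r₂ : ℝ} (hr₁ : 0 < r₁) (hr₁₂ : r₁ < r₂) {U : Set E} (hU : IsOpen U)
    (hb : Bornology.IsBounded U) :
    volume (U ∩ (Metric.ball 0 r₂ \ Metric.closedBall 0 r₁)) ≤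
      ENNReal.ofReal ((r₂ ^ (n + 1) - r₁ ^ (n + 1)) / ((n + 1) * r₂ ^ n)) *
        μHE[n] (frontier U) := by
  set S : Set E := Metric.ball 0 r₂ \ Metric.closedBall 0 r₁
  set C : ℝ := (r₂ ^ (n + 1) - r₁ ^ (n + 1)) / ((n + 1) * r₂ ^ n)
  have hr₂ : 0 < r₂ := hr₁.trans hr₁₂
  have hCpos : 0 < C := by
    have : r₁ ^ (n + 1) < r₂ ^ (n + 1) := pow_lt_pow_left₀ hr₁₂ hr₁.le (by simp)
    exact div_pos (by linarith) (by positivity)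
  have hS0 : (0 : E) ∉ S := fun h => h.2 (by simp [hr₁.le])
  have hle : ∀ c : ℝ, C < c → volume (U ∩ S) ≤ ENNReal.ofReal c * μHE[n] (frontier U) := by
    intro c hc
    refine (measure_mono (inter_subset_radialShadow_frontier hU hb hS0)).trans ?_
    refine OuterMeasure.le_mul_of_locally_le (radialShadowOuterMeasure volume S) _ _ (fun y => ?_)
      isClosed_frontier.measurableSet
    obtain ⟨V, hV, h⟩ := exists_nhds_volume_radialShadow_le hn hr₁ hr₁₂ hc y
    exact ⟨V, hV, fun A hA _ => h A hA⟩
  -- Letting c decrease to C requires finite area; infinite area is trivial as C > 0.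
  by_cases htop : μHE[n] (frontier U) = ⊤
  · rw [htop, ENNReal.mul_top (by simpa using hCpos)]
    exact le_top
  · have hlim : Filter.Tendsto (fun c : ℝ => ENNReal.ofReal c * μHE[n] (frontier U))
        (nhdsWithin C (Ioi C)) (nhds (ENNReal.ofReal C * μHE[n] (frontier U))) :=
      (ENNReal.Tendsto.mul_const (ENNReal.continuous_ofReal.tendsto C) (Or.inr htop)).mono_left
        nhdsWithin_le_nhds
    exact ge_of_tendsto hlim (eventually_nhdsWithin_of_forall fun c hc => hle c hc)

end RadialShadow

/-! ### Hausdorff area of spheres -/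

section Sphere

/-- The radial projection onto the unit sphere does not increase distances outside the unit
ball. -/
theorem norm_inv_norm_smul_sub_le {E : Type*} [NormedAddCommGroup E] [InnerProductSpace ℝ E]
    {x y : E} (hx : 1 ≤ ‖x‖) (hy : 1 ≤ ‖y‖) : ‖‖x‖⁻¹ • x - ‖y‖⁻¹ • y‖ ≤ ‖x - y‖ := by
  have hx0 : 0 < ‖x‖ := by linarith
  have hy0 : 0 < ‖y‖ := by linarith
  refine (abs_le_of_sq_le_sq' ?_ (norm_nonneg _)).2
  rw [norm_sub_sq_real, norm_sub_sq_real, inner_smul_left, inner_smul_right, norm_smul, norm_smul]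
  simp only [norm_inv, norm_norm, RCLike.conj_to_real]
  rw [inv_mul_cancel₀ hx0.ne', inv_mul_cancel₀ hy0.ne']
  have hi := real_inner_le_norm x y
  set a := ‖x‖
  set b := ‖y‖
  set c : ℝ := a⁻¹ * (b⁻¹ * inner ℝ x y) with hc
  have hxy : inner ℝ x y = a * b * c := by rw [hc]; field_simp
  rw [hxy] at hi ⊢
  have hab : 0 < a * b := by positivity
  have hc1 : c ≤ 1 := by nlinarith
  have hab1 : 1 ≤ a * b := by nlinarith
  nlinarith [sq_nonneg (a - b), mul_nonneg (sub_nonneg.2 hc1) (sub_nonneg.2 hab1)]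

open scoped Pointwise

variable {E : Type*} [NormedAddCommGroup E] [InnerProductSpace ℝ E] [FiniteDimensional ℝ E]
  [MeasurableSpace E] [BorelSpace E]

/-- A is lifted radially to D in the tangent hyperplane at u. Projecting back is 1-Lipschitz, so A
has no more area than D. The cone over D below height κ sits inside the cone over A, whose volume
defines `toSphere`; comparing volumes costs κ^(-(n+1)) < c. -/
theorem exists_nhds_euclideanHausdorffMeasure_le_toSphere {n : ℕ}
    (hn : Module.finrank ℝ E = n + 1) {c : ℝ} (hc : 1 < c) (u : Metric.sphere (0 : E) 1) :
    ∃ U ∈ nhds u, ∀ A ⊆ U, MeasurableSet A →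
      μHE[n] A ≤ ENNReal.ofReal c * (volume : Measure E).toSphere A := by
  have hu : ‖(u : E)‖ = 1 := norm_eq_of_mem_sphere u
  obtain ⟨κ, hκlt, hκ⟩ : ∃ κ : ℝ, 1 < c * κ ^ (n + 1) ∧ κ ∈ Ioo (0 : ℝ) 1 := by
    have hcont : Continuous fun κ : ℝ => c * κ ^ (n + 1) := by fun_prop
    have hev : ∀ᶠ κ in nhdsWithin (1 : ℝ) (Iio 1), 1 < c * κ ^ (n + 1) :=
      ((hcont.tendsto 1).mono_left nhdsWithin_le_nhds).eventually_const_lt (by simpa using hc)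
    exact (hev.and (Ioo_mem_nhdsLT zero_lt_one)).exists
  refine ⟨{y | κ < inner ℝ (u : E) (y : E)}, ?_, fun A hA hAm => ?_⟩
  · refine (isOpen_lt continuous_const (by fun_prop)).mem_nhds ?_
    simpa [hu] using hκ.2
  let A' : Set E := (↑) '' A
  have hA'm : MeasurableSet A' :=
    (MeasurableEmbedding.subtype_coe Metric.isClosed_sphere.measurableSet).measurableSet_image.2 hAm
  let D : Set E := {z | inner ℝ (u : E) z = 1 ∧ ‖z‖⁻¹ • z ∈ A'}
  have hDm : MeasurableSet D := by
    have h1 : Measurable fun z : E => ‖z‖⁻¹ • z := by fun_prop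
    exact (isClosed_eq (by fun_prop) continuous_const).measurableSet.inter (h1 hA'm)
  have hA' : ∀ y ∈ A', ‖y‖ = 1 ∧ κ < inner ℝ (u : E) y := by
    rintro _ ⟨y, hy, rfl⟩
    exact ⟨norm_eq_of_mem_sphere y, hA hy⟩
  have hDnorm : ∀ z ∈ D, 1 ≤ ‖z‖ := fun z hz => by
    have := real_inner_le_norm (u : E) z
    rwa [hz.1, hu, one_mul] at this
  have himage : A' ⊆ (fun z : E => ‖z‖⁻¹ • z) '' D := by
    intro y hy
    obtain ⟨hy1, hyκ⟩ := hA' y hy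
    have hpos : 0 < inner ℝ (u : E) y := hκ.1.trans hyκ
    have hq : ‖(inner ℝ (u : E) y : ℝ)⁻¹ • y‖⁻¹ • ((inner ℝ (u : E) y : ℝ)⁻¹ • y) = y := by
      rw [norm_smul, hy1, mul_one, norm_inv, inv_inv, Real.norm_of_nonneg hpos.le, smul_smul,
        mul_inv_cancel₀ hpos.ne', one_smul]
    refine ⟨(inner ℝ (u : E) y : ℝ)⁻¹ • y, ⟨?_, ?_⟩, hq⟩
    · rw [inner_smul_right, inv_mul_cancel₀ hpos.ne']
    · rwa [hq]
  have hLip : LipschitzOnWith 1 (fun z : E => ‖z‖⁻¹ • z) D :=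
    LipschitzOnWith.of_dist_le_mul fun z hz w hw => by
      simpa [dist_eq_norm] using norm_inv_norm_smul_sub_le (hDnorm z hz) (hDnorm w hw)
  have hle : μHE[n] A ≤ μHE[n] D := by
    calc μHE[n] A = μHE[n] A' := (isometry_subtype_coe.euclideanHausdorffMeasure_image A).symm
      _ ≤ _ := measure_mono himage
      _ ≤ μHE[n] D := by simpa using hLip.euclideanHausdorffMeasure_image_le n
  -- Points of D have norm below 1/κ, so points of their cone below height κ have norm below 1.
  have hcone : coneSlab (u : E) 1 0 κ D ⊆ Ioo (0 : ℝ) 1 • A' := by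
    rintro x ⟨hx0, hxκ, hx1, hxA⟩
    obtain ⟨hy1, hyκ⟩ := hA' _ hxA
    set z : E := (1 / inner ℝ (u : E) x) • x with hz
    have hz0 : 0 < ‖z‖ := zero_lt_one.trans_le (hDnorm z ⟨hx1, hxA⟩)
    rw [inner_smul_right, hx1, mul_one] at hyκ
    refine ⟨inner ℝ (u : E) x * ‖z‖, ⟨by positivity, ?_⟩, ‖z‖⁻¹ • z, hxA, ?_⟩
    · have : κ * ‖z‖ < 1 := by
        rw [lt_inv_comm₀ hκ.1 hz0] at hyκ
        calc κ * ‖z‖ < κ * κ⁻¹ := by have := hκ.1; gcongr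
          _ = 1 := mul_inv_cancel₀ hκ.1.ne'
      nlinarith
    · simp only [smul_smul]
      rw [mul_assoc, mul_inv_cancel₀ hz0.ne', mul_one, hz, smul_smul, mul_one_div_cancel hx0.ne',
        one_smul]
  have hvol := volume_coneSlab hn hu zero_lt_one le_rfl hκ.1.le hDm fun z hz => hz.1
  rw [Measure.toSphere_apply' _ hAm, hn]
  refine hle.trans ?_
  calc μHE[n] D = ENNReal.ofReal 1 * μHE[n] D := by simp
    _ ≤ ENNReal.ofReal (c * ((n + 1) * (κ ^ (n + 1) / (n + 1)))) * μHE[n] D := by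
        refine mul_le_mul' (ENNReal.ofReal_le_ofReal ?_) le_rfl
        rw [mul_div_cancel₀ _ (by positivity)]
        exact hκlt.le
    _ = ENNReal.ofReal c * ((n + 1 : ℕ) * volume (coneSlab (u : E) 1 0 κ D)) := by
        rw [hvol, ENNReal.ofReal_mul (by linarith), ENNReal.ofReal_mul (by positivity), mul_assoc,
          mul_assoc]
        congr 2
        · rw [← ENNReal.ofReal_natCast]; simp
        · simp
    _ ≤ _ := by gcongr

theorem euclideanHausdorffMeasure_unit_sphere_le {n : ℕ} (hn : Module.finrank ℝ E = n + 1) :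
    μHE[n] (Metric.sphere (0 : E) 1) ≤ (volume : Measure E).toSphere univ := by
  have h1 : μHE[n] (Metric.sphere (0 : E) 1) =
      μHE[n] (univ : Set (Metric.sphere (0 : E) 1)) := by
    rw [← (isometry_subtype_coe (s := Metric.sphere (0 : E) 1)).euclideanHausdorffMeasure_image,
      image_univ, Subtype.range_coe]
  rw [h1]
  have hle : ∀ c : ℝ, 1 < c → μHE[n] (univ : Set (Metric.sphere (0 : E) 1)) ≤
      ENNReal.ofReal c * (volume : Measure E).toSphere univ := fun c hc =>
    OuterMeasure.le_mul_of_locally_le (μHE[n] : Measure (Metric.sphere (0 : E) 1)).toOuterMeasure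
      _ _ (exists_nhds_euclideanHausdorffMeasure_le_toSphere hn hc) MeasurableSet.univ
  have hlim : Filter.Tendsto
      (fun c : ℝ => ENNReal.ofReal c * (volume : Measure E).toSphere univ)
      (nhdsWithin 1 (Ioi 1)) (nhds (ENNReal.ofReal 1 * (volume : Measure E).toSphere univ)) :=
    (ENNReal.Tendsto.mul_const (ENNReal.continuous_ofReal.tendsto 1)
      (Or.inr (measure_ne_top _ _))).mono_left nhdsWithin_le_nhds
  simpa using ge_of_tendsto hlim (eventually_nhdsWithin_of_forall fun c hc => hle c hc)

/-- Identifies the flux constant as the volume of the shell divided by the `toSphere` area of its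
outer sphere. -/
theorem volume_shell {n : ℕ} (hn : Module.finrank ℝ E = n + 1) {r₁ r₂ : ℝ} (hr₁ : 0 < r₁)
    (hr₁₂ : r₁ < r₂) :
    volume (Metric.ball (0 : E) r₂ \ Metric.closedBall 0 r₁) =
      ENNReal.ofReal ((r₂ ^ (n + 1) - r₁ ^ (n + 1)) / ((n + 1) * r₂ ^ n)) *
        (ENNReal.ofReal (r₂ ^ n) * (volume : Measure E).toSphere univ) := by
  have : Nontrivial E := Module.nontrivial_of_finrank_pos (R := ℝ) (by omega)
  have hr₂ : 0 < r₂ := hr₁.trans hr₁₂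
  have h12 : r₁ ^ (n + 1) < r₂ ^ (n + 1) := pow_lt_pow_left₀ hr₁₂ hr₁.le (by simp)
  rw [measure_sdiff (Metric.closedBall_subset_ball hr₁₂)
      Metric.isClosed_closedBall.measurableSet.nullMeasurableSet
      (measure_closedBall_lt_top).ne, Measure.addHaar_closedBall _ _ hr₁.le,
    Measure.addHaar_ball _ _ hr₂.le, Measure.toSphere_apply_univ, hn,
    ← ENNReal.sub_mul (fun _ _ => measure_ball_lt_top.ne), ← ENNReal.ofReal_sub _ (by positivity),
    ← mul_assoc, ← mul_assoc, ← ENNReal.ofReal_mul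
      (div_nonneg (by linarith) (by positivity)), ← ENNReal.ofReal_natCast,
    ← ENNReal.ofReal_mul (mul_nonneg (div_nonneg (by linarith) (by positivity)) (by positivity))]
  congr 2
  push_cast
  field_simp

theorem euclideanHausdorffMeasure_sphere {n : ℕ} (hn : Module.finrank ℝ E = n + 1) {r : ℝ}
    (hr : 0 < r) :
    μHE[n] (Metric.sphere (0 : E) r) =
      ENNReal.ofReal (r ^ n) * (volume : Measure E).toSphere univ := by
  have : Nontrivial E := Module.nontrivial_of_finrank_pos (R := ℝ) (by omega)
  refine le_antisymm ?_ ?_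
  · have hs : Metric.sphere (0 : E) r = r • Metric.sphere (0 : E) 1 := by
      rw [smul_sphere _ _ zero_le_one]
      simp [abs_of_pos hr]
    rw [hs, Measure.euclideanHausdorffMeasure_smul₀ n hr.ne', ENNReal.smul_def, smul_eq_mul]
    refine mul_le_mul' (le_of_eq ?_) (euclideanHausdorffMeasure_unit_sphere_le hn)
    rw [ENNReal.ofReal_pow hr.le, ENNReal.coe_pow, ← enorm_eq_nnnorm, Real.enorm_of_nonneg hr.le]
  -- For the lower bound, the shadow inequality is applied to the ball itself. The inner radius r /
  -- 2 is arbitrary, since the flux constant cancels.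
  · have hr2 : r / 2 < r := half_lt_self hr
    have h := volume_inter_shell_le hn (half_pos hr) hr2 (U := Metric.ball (0 : E) r)
      Metric.isOpen_ball Metric.isBounded_ball
    rw [inter_eq_right.2 sdiff_subset, volume_shell hn (half_pos hr) hr2,
      frontier_ball _ hr.ne'] at h
    refine (ENNReal.mul_le_mul_iff_right ?_ ENNReal.ofReal_ne_top).1 h
    have h12 : (r / 2) ^ (n + 1) < r ^ (n + 1) := pow_lt_pow_left₀ hr2 (by positivity) (by simp)
    simpa using div_pos (sub_pos.2 h12) (by positivity)

end Sphere

/-! ### The shell inequality for smooth functions -/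

section Polar

variable {E : Type*} [NormedAddCommGroup E]

theorem lintegral_polar [NormedSpace ℝ E] [FiniteDimensional ℝ E]
    [MeasurableSpace E] [BorelSpace E] (μ : Measure E) [μ.IsAddHaarMeasure] {n : ℕ}
    (hn : Module.finrank ℝ E = n + 1) {f : E → ℝ≥0∞} (hf : Measurable f) :
    ∫⁻ x, f x ∂μ = ∫⁻ θ : Metric.sphere (0 : E) 1,
      ∫⁻ r in Ioi (0 : ℝ), ENNReal.ofReal (r ^ n) * f (r • (θ : E)) ∂volume ∂μ.toSphere := by
  have : Nontrivial E := Module.nontrivial_of_finrank_pos (R := ℝ) (by omega)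
  have hmp := μ.measurePreserving_homeomorphUnitSphereProd
  rw [hn, Nat.add_sub_cancel] at hmp
  have hF : Measurable fun p : Metric.sphere (0 : E) 1 × Ioi (0 : ℝ) =>
      f ((p.2 : ℝ) • (p.1 : E)) := hf.comp (by fun_prop)
  calc ∫⁻ x, f x ∂μ = ∫⁻ x : ({(0)}ᶜ : Set E), f x ∂(μ.comap (↑)) := by
        rw [lintegral_subtype_comap (measurableSet_singleton _).compl,
          restrict_compl_singleton]
    _ = ∫⁻ p, f ((p.2 : ℝ) • (p.1 : E)) ∂(μ.toSphere.prod (.volumeIoiPow n)) := by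
        rw [← hmp.lintegral_comp hF]
        refine lintegral_congr fun x => ?_
        congr 1
        exact (congrArg Subtype.val ((homeomorphUnitSphereProd E).symm_apply_apply x)).symm
    _ = ∫⁻ θ, ∫⁻ r : Ioi (0 : ℝ), f ((r : ℝ) • (θ : E)) ∂(.volumeIoiPow n) ∂μ.toSphere :=
        lintegral_prod _ hF.aemeasurable
    _ = _ := by
        refine lintegral_congr fun θ => ?_
        have h1 : Measurable fun r : ℝ => f (r • (θ : E)) := hf.comp (by fun_prop)
        refine (lintegral_withDensity_eq_lintegral_mul _ (by fun_prop)
          (h1.comp measurable_subtype_coe)).trans ?_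
        exact lintegral_subtype_comap measurableSet_Ioi
          fun r : ℝ => ENNReal.ofReal (r ^ n) * f (r • (θ : E))

/-- After Tonelli, m s carries the weight ∫ r^n dr over (r₁, min r₂ s), which the flux bound at
distance s estimates by the constant times s^n. -/
theorem lintegral_Ioo_pow_mul_le (n : ℕ) {r₁ r₂ : ℝ} (hr₁ : 0 < r₁) (hr₁₂ : r₁ < r₂)
    {f m : ℝ → ℝ≥0∞} (hm : Measurable m) (hfm : ∀ r, 0 < r → f r ≤ ∫⁻ s in Ioi r, m s) :
    ∫⁻ r in Ioo r₁ r₂, ENNReal.ofReal (r ^ n) * f r ≤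
      ENNReal.ofReal ((r₂ ^ (n + 1) - r₁ ^ (n + 1)) / ((n + 1) * r₂ ^ n)) *
        ∫⁻ s in Ioi (0 : ℝ), ENNReal.ofReal (s ^ n) * m s := by
  have hr₂ : 0 < r₂ := hr₁.trans hr₁₂
  let T : Set (ℝ × ℝ) := {p | r₁ < p.1 ∧ p.1 < r₂ ∧ p.1 < p.2}
  have hT : MeasurableSet T := (measurableSet_lt measurable_const measurable_fst).inter
    ((measurableSet_lt measurable_fst measurable_const).inter
      (measurableSet_lt measurable_fst measurable_snd))
  let F : ℝ × ℝ → ℝ≥0∞ := T.indicator fun p => ENNReal.ofReal (p.1 ^ n) * m p.2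
  have hF : Measurable F := Measurable.indicator (by fun_prop) hT
  have hF1 : ∀ r s, r₁ < r → r < r₂ → r < s → F (r, s) = ENNReal.ofReal (r ^ n) * m s :=
    fun r s h1 h2 h3 => indicator_of_mem (show (r, s) ∈ T from ⟨h1, h2, h3⟩) _
  have hF0 : ∀ r s, ¬ (r₁ < r ∧ r < r₂ ∧ r < s) → F (r, s) = 0 :=
    fun r s h => indicator_of_notMem (show (r, s) ∉ T from h) _
  calc ∫⁻ r in Ioo r₁ r₂, ENNReal.ofReal (r ^ n) * f r
      ≤ ∫⁻ r, ∫⁻ s, F (r, s) := by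
        rw [← lintegral_indicator measurableSet_Ioo]
        refine lintegral_mono fun r => ?_
        by_cases hr : r ∈ Ioo r₁ r₂
        · rw [indicator_of_mem hr]
          refine (mul_le_mul' le_rfl (hfm r (hr₁.trans hr.1))).trans_eq ?_
          rw [← lintegral_const_mul _ hm, ← lintegral_indicator measurableSet_Ioi]
          refine lintegral_congr fun s => ?_
          by_cases hs : r < s
          · rw [indicator_of_mem (show s ∈ Ioi r from hs), hF1 r s hr.1 hr.2 hs]
          · rw [indicator_of_notMem (show s ∉ Ioi r from hs), hF0 r s fun h => hs h.2.2]
        · rw [indicator_of_notMem hr]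
          exact zero_le
    _ = ∫⁻ s, ∫⁻ r, F (r, s) := lintegral_lintegral_swap hF.aemeasurable
    _ ≤ ∫⁻ s, (Ioi (0 : ℝ)).indicator (fun s =>
          ENNReal.ofReal ((r₂ ^ (n + 1) - r₁ ^ (n + 1)) / ((n + 1) * r₂ ^ n)) *
            (ENNReal.ofReal (s ^ n) * m s)) s := by
        refine lintegral_mono fun s => ?_
        by_cases hs : 0 < s
        · rw [indicator_of_mem (show s ∈ Ioi (0 : ℝ) from hs), ← mul_assoc,
            ← ENNReal.ofReal_mul' (by positivity)]
          -- Dividing by 1 matches the form of `lintegral_Ioo_div_pow` at ρ = 1.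
          calc ∫⁻ r, F (r, s)
              = ∫⁻ r in Ioo r₁ (min r₂ s), ENNReal.ofReal ((r / 1) ^ n) * m s := by
                rw [← lintegral_indicator measurableSet_Ioo]
                refine lintegral_congr fun r => ?_
                by_cases hr : r ∈ Ioo r₁ (min r₂ s)
                · rw [indicator_of_mem hr, hF1 r s hr.1 (hr.2.trans_le (min_le_left _ _))
                    (hr.2.trans_le (min_le_right _ _)), div_one]
                · rw [indicator_of_notMem hr, hF0 r s fun h => hr ⟨h.1, lt_min h.2.1 h.2.2⟩]
            _ ≤ _ := by
                rw [lintegral_mul_const _ (by fun_prop),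
                  lintegral_Ioo_div_pow n one_pos hr₁.le (le_min hr₂.le hs.le)]
                refine mul_le_mul' (ENNReal.ofReal_le_ofReal ?_) le_rfl
                have := min_pow_sub_pow_div_le n hr₁ hr₁₂ hs
                calc _ = (min r₂ s ^ (n + 1) - r₁ ^ (n + 1)) / ((n + 1) * s ^ n) * s ^ n := by
                      field_simp
                      simp
                  _ ≤ _ := by gcongr
        · rw [indicator_of_notMem (show s ∉ Ioi (0 : ℝ) from hs)]
          have : ∀ r, F (r, s) = 0 := fun r =>
            hF0 r s fun h => hs ((hr₁.trans h.1).trans h.2.2)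
          simp [this]
    _ = _ := by
        rw [lintegral_indicator measurableSet_Ioi, lintegral_const_mul _ (by fun_prop)]

variable [InnerProductSpace ℝ E] [FiniteDimensional ℝ E]

theorem norm_gradient_eq_norm_fderiv (φ : E → ℝ) (x : E) : ‖gradient φ x‖ = ‖fderiv ℝ φ x‖ := by
  rw [← toDual_gradient, LinearIsometryEquiv.norm_map]

theorem ContDiff.continuous_gradient {φ : E → ℝ} (hφ : ContDiff ℝ 1 φ) :
    Continuous (gradient φ) := by
  have := hφ.continuous_fderiv (by simp)
  unfold gradient
  exact (LinearIsometryEquiv.continuous _).comp this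

theorem enorm_le_lintegral_ray {φ : E → ℝ} (hφ : ContDiff ℝ 1 φ) (hc : HasCompactSupport φ)
    {θ : E} (hθ : ‖θ‖ = 1) (r : ℝ) :
    ‖φ (r • θ)‖ₑ ≤ ∫⁻ s in Ioi r, ‖gradient φ (s • θ)‖ₑ := by
  have hiso : Isometry fun s : ℝ => s • θ := Isometry.of_dist_eq fun s t => by
    rw [dist_eq_norm, ← sub_smul, norm_smul, hθ, mul_one, dist_eq_norm]
  have hg : ContDiff ℝ 1 fun s : ℝ => φ (s • θ) := hφ.comp (by fun_prop)
  have hgc : HasCompactSupport fun s : ℝ => φ (s • θ) :=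
    hc.comp_isClosedEmbedding hiso.isClosedEmbedding
  have hint := hgc.integral_Ioi_deriv_eq hg r
  have : ‖φ (r • θ)‖ₑ = ‖∫ s in Ioi r, deriv (fun s : ℝ => φ (s • θ)) s‖ₑ := by
    rw [hint, enorm_neg]
  rw [this]
  refine (enorm_integral_le_lintegral_enorm _).trans (lintegral_mono fun s => ?_)
  have hd : HasDerivAt (fun s : ℝ => φ (s • θ)) (fderiv ℝ φ (s • θ) θ) s := by
    have h1 : HasDerivAt (fun s : ℝ => s • θ) θ s := by
      simpa using (hasDerivAt_id s).smul_const θ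
    exact ((hφ.differentiable (by simp)) (s • θ)).hasFDerivAt.comp_hasDerivAt s h1
  rw [hd.deriv, enorm_le_iff_norm_le, norm_gradient_eq_norm_fderiv]
  simpa [hθ] using (fderiv ℝ φ (s • θ)).le_opNorm θ

/-- The sharp shell inequality for compactly supported `C¹` functions. -/
theorem lintegral_shell_enorm_le [MeasurableSpace E] [BorelSpace E] {n : ℕ}
    (hn : Module.finrank ℝ E = n + 1)
    {r₁ r₂ : ℝ} (hr₁ : 0 < r₁) (hr₁₂ : r₁ < r₂) {φ : E → ℝ} (hφ : ContDiff ℝ 1 φ)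
    (hc : HasCompactSupport φ) :
    ∫⁻ x in Metric.ball 0 r₂ \ Metric.closedBall 0 r₁, ‖φ x‖ₑ ≤
      ENNReal.ofReal ((r₂ ^ (n + 1) - r₁ ^ (n + 1)) / ((n + 1) * r₂ ^ n)) *
        ∫⁻ x, ‖gradient φ x‖ₑ := by
  have hSm : MeasurableSet (Metric.ball (0 : E) r₂ \ Metric.closedBall 0 r₁) :=
    measurableSet_ball.diff measurableSet_closedBall
  have hφm : Measurable fun x => ‖φ x‖ₑ := hφ.continuous.enorm.measurable
  have hgm : Measurable fun x => ‖gradient φ x‖ₑ := hφ.continuous_gradient.enorm.measurable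
  have hG : Measurable fun p : Metric.sphere (0 : E) 1 × ℝ =>
      ENNReal.ofReal (p.2 ^ n) * ‖gradient φ (p.2 • (p.1 : E))‖ₑ :=
    Measurable.mul (by fun_prop) (hgm.comp (by fun_prop))
  rw [← lintegral_indicator hSm, lintegral_polar volume hn (hφm.indicator hSm),
    lintegral_polar volume hn hgm, ← lintegral_const_mul _ hG.lintegral_prod_right']
  refine lintegral_mono fun θ => ?_
  have hθ : ‖(θ : E)‖ = 1 := norm_eq_of_mem_sphere θ
  refine le_trans (le_of_eq ?_) (lintegral_Ioo_pow_mul_le n hr₁ hr₁₂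
    (f := fun r => ‖φ (r • (θ : E))‖ₑ) (m := fun s => ‖gradient φ (s • (θ : E))‖ₑ)
    (hgm.comp (by fun_prop)) fun r _ => enorm_le_lintegral_ray hφ hc hθ r)
  rw [← lintegral_indicator measurableSet_Ioi, ← lintegral_indicator measurableSet_Ioo]
  refine lintegral_congr fun r => ?_
  by_cases hr : 0 < r
  · rw [indicator_of_mem (show r ∈ Ioi (0 : ℝ) from hr)]
    by_cases hr' : r ∈ Ioo r₁ r₂
    · rw [indicator_of_mem hr', indicator_of_mem]
      simpa [norm_smul, hθ, abs_of_pos hr] using hr'.symm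
    · rw [indicator_of_notMem hr', indicator_of_notMem, mul_zero]
      simpa [norm_smul, hθ, abs_of_pos hr] using fun h1 h2 => hr' ⟨h2, h1⟩
  · rw [indicator_of_notMem (show r ∉ Ioi (0 : ℝ) from hr),
      indicator_of_notMem fun h => hr (hr₁.trans h.1)]

end Polar

/-! ### Radial cutoffs and their gradient integral -/

section Cutoff

/-- The radial profile that equals `1` up to radius `a` and `0` from radius `b` on, as a function
of the squared radius. -/
noncomputable def cutoffProfile (a b t : ℝ) : ℝ :=
  Real.smoothTransition ((b ^ 2 - t) / (b ^ 2 - a ^ 2))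

theorem contDiff_cutoffProfile (a b : ℝ) : ContDiff ℝ ∞ (cutoffProfile a b) :=
  Real.smoothTransition.contDiff.comp (by fun_prop)

variable {a b : ℝ}

theorem antitone_cutoffProfile (ha : 0 ≤ a) (hab : a < b) : Antitone (cutoffProfile a b) := by
  intro s t hst
  have : 0 < b ^ 2 - a ^ 2 := by nlinarith
  refine Real.smoothTransition.monotone ?_
  gcongr

theorem cutoffProfile_eq_one (ha : 0 ≤ a) (hab : a < b) {t : ℝ} (ht : t ≤ a ^ 2) :
    cutoffProfile a b t = 1 := by
  have : 0 < b ^ 2 - a ^ 2 := by nlinarith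
  refine Real.smoothTransition.one_of_one_le ?_
  rw [one_le_div this]
  linarith

theorem cutoffProfile_eq_zero (ha : 0 ≤ a) (hab : a < b) {t : ℝ} (ht : b ^ 2 ≤ t) :
    cutoffProfile a b t = 0 := by
  have : 0 < b ^ 2 - a ^ 2 := by nlinarith
  exact Real.smoothTransition.zero_of_nonpos (div_nonpos_of_nonpos_of_nonneg (by linarith) this.le)

theorem hasCompactSupport_cutoffProfile_norm_sq {E : Type*} [NormedAddCommGroup E] [ProperSpace E]
    (ha : 0 ≤ a) (hab : a < b) :
    HasCompactSupport (fun x : E => cutoffProfile a b (‖x‖ ^ 2)) :=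
  HasCompactSupport.intro (isCompact_closedBall (0 : E) b) fun x hx => by
    have : b < ‖x‖ := by simpa using hx
    exact cutoffProfile_eq_zero ha hab (by nlinarith)

theorem tsupport_cutoffProfile_norm_sq_subset {E : Type*} [NormedAddCommGroup E]
    (ha : 0 ≤ a) (hab : a < b) :
    tsupport (fun x : E => cutoffProfile a b (‖x‖ ^ 2)) ⊆ Metric.closedBall 0 b := by
  refine closure_minimal (fun x hx => ?_) Metric.isClosed_closedBall
  by_contra hx'
  have : b < ‖x‖ := by simpa using hx'
  exact hx (cutoffProfile_eq_zero ha hab (by nlinarith))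

theorem hasDerivAt_cutoffProfile_sq (r : ℝ) :
    HasDerivAt (fun r : ℝ => cutoffProfile a b (r ^ 2))
      (deriv (cutoffProfile a b) (r ^ 2) * (2 * r)) r := by
  have h1 : HasDerivAt (fun r : ℝ => r ^ 2) (2 * r) r := by simpa using hasDerivAt_pow 2 r
  exact HasDerivAt.comp (h₂ := cutoffProfile a b) r
    (((contDiff_cutoffProfile a b).differentiable (by simp)) (r ^ 2)).hasDerivAt h1

/-- A monotone profile descending from 1 to 0 has total variation 1. -/
theorem lintegral_Ioi_enorm_deriv_cutoffProfile_sq (ha : 0 ≤ a) (hab : a < b) :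
    ∫⁻ r in Ioi (0 : ℝ), ‖deriv (fun r : ℝ => cutoffProfile a b (r ^ 2)) r‖ₑ = 1 := by
  set h : ℝ → ℝ := fun r => cutoffProfile a b (r ^ 2) with hh
  have hcd : ContDiff ℝ 1 h :=
    ((contDiff_cutoffProfile a b).comp (by fun_prop : ContDiff ℝ ∞ fun r : ℝ => r ^ 2)).of_le
      (by norm_cast)
  have hcs : HasCompactSupport h := by
    simpa [hh] using hasCompactSupport_cutoffProfile_norm_sq (E := ℝ) ha hab
  have hcont : Continuous (deriv h) := hcd.continuous_deriv (by simp)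
  have hint : Integrable (deriv h) := hcont.integrable_of_hasCompactSupport hcs.deriv
  have hneg : ∀ r ∈ Ioi (0 : ℝ), deriv h r ≤ 0 := fun r hr => by
    have hr : 0 < r := hr
    rw [(hasDerivAt_cutoffProfile_sq r).deriv]
    exact mul_nonpos_of_nonpos_of_nonneg (antitone_cutoffProfile ha hab).deriv_nonpos
      (by positivity)
  calc ∫⁻ r in Ioi (0 : ℝ), ‖deriv h r‖ₑ = ∫⁻ r in Ioi (0 : ℝ), ENNReal.ofReal (-deriv h r) := by
        refine setLIntegral_congr_fun measurableSet_Ioi fun r hr => ?_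
        rw [← enorm_neg, Real.enorm_of_nonneg (neg_nonneg.2 (hneg r hr))]
    _ = ENNReal.ofReal (∫ r in Ioi (0 : ℝ), -deriv h r) := by
        refine (ofReal_integral_eq_lintegral_ofReal hint.neg.integrableOn ?_).symm
        filter_upwards [ae_restrict_mem measurableSet_Ioi] with r hr
        exact neg_nonneg.2 (hneg r hr)
    _ = 1 := by
        rw [integral_neg, hcs.integral_Ioi_deriv_eq hcd, neg_neg]
        simp [hh, cutoffProfile_eq_one ha hab (sq_nonneg a)]

variable {E : Type*} [NormedAddCommGroup E] [InnerProductSpace ℝ E] [FiniteDimensional ℝ E]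

theorem norm_gradient_cutoffProfile_norm_sq {θ : E} (hθ : ‖θ‖ = 1) {r : ℝ} :
    ‖gradient (fun x : E => cutoffProfile a b (‖x‖ ^ 2)) (r • θ)‖ =
      ‖deriv (fun r : ℝ => cutoffProfile a b (r ^ 2)) r‖ := by
  have h1 := (((contDiff_cutoffProfile a b).differentiable (by simp))
    (‖r • θ‖ ^ 2)).hasDerivAt.comp_hasFDerivAt (r • θ)
      (hasStrictFDerivAt_norm_sq (r • θ)).hasFDerivAt
  rw [norm_gradient_eq_norm_fderiv, (hasDerivAt_cutoffProfile_sq r).deriv,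
    show fderiv ℝ (fun x : E => cutoffProfile a b (‖x‖ ^ 2)) (r • θ) = _ from h1.fderiv]
  rw [← Nat.cast_smul_eq_nsmul ℝ, norm_smul (deriv _ _), norm_smul (_ : ℝ) (innerSL ℝ _),
    innerSL_apply_norm]
  simp [norm_smul, hθ]

variable [MeasurableSpace E] [BorelSpace E]

/-- In polar coordinates the weight r^n is at most b^n wherever the gradient is nonzero, and each
ray contributes variation 1. -/
theorem lintegral_enorm_gradient_cutoff_le {n : ℕ} (hn : Module.finrank ℝ E = n + 1)
    (ha : 0 ≤ a) (hab : a < b) :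
    ∫⁻ x, ‖gradient (fun x : E => cutoffProfile a b (‖x‖ ^ 2)) x‖ₑ ≤
      ENNReal.ofReal (b ^ n) * (volume : Measure E).toSphere univ := by
  have hcd : ContDiff ℝ 1 fun x : E => cutoffProfile a b (‖x‖ ^ 2) :=
    ((contDiff_cutoffProfile a b).comp (contDiff_norm_sq ℝ)).of_le (by norm_cast)
  rw [lintegral_polar volume hn hcd.continuous_gradient.enorm.measurable]
  calc _ ≤ ∫⁻ θ : Metric.sphere (0 : E) 1, ENNReal.ofReal (b ^ n) ∂(volume : Measure E).toSphere :=
        lintegral_mono fun θ => ?_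
    _ = _ := by rw [lintegral_const]
  have hθ : ‖(θ : E)‖ = 1 := norm_eq_of_mem_sphere θ
  have hh : Measurable fun r : ℝ => ‖deriv (fun r : ℝ => cutoffProfile a b (r ^ 2)) r‖ₑ :=
    (measurable_deriv _).enorm
  calc _ ≤ ∫⁻ r in Ioi (0 : ℝ), ENNReal.ofReal (b ^ n) *
        ‖deriv (fun r : ℝ => cutoffProfile a b (r ^ 2)) r‖ₑ := by
        refine setLIntegral_mono (by fun_prop) fun r hr => ?_
        have hr : 0 < r := hr
        have he : ‖gradient (fun x : E => cutoffProfile a b (‖x‖ ^ 2)) (r • (θ : E))‖ₑ =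
            ‖deriv (fun r : ℝ => cutoffProfile a b (r ^ 2)) r‖ₑ := by
          rw [← ofReal_norm, ← ofReal_norm,
            norm_gradient_cutoffProfile_norm_sq hθ]
        rw [he]
        rcases le_or_gt r b with hrb | hrb
        · gcongr
        · have : deriv (fun r : ℝ => cutoffProfile a b (r ^ 2)) r = 0 := by
            have hev : (fun r : ℝ => cutoffProfile a b (r ^ 2)) =ᶠ[nhds r] fun _ => 0 := by
              filter_upwards [lt_mem_nhds hrb] with s hs
              exact cutoffProfile_eq_zero ha hab (by nlinarith)
            rw [hev.deriv_eq, deriv_const]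
          simp [this]
    _ = ENNReal.ofReal (b ^ n) := by
        rw [lintegral_const_mul _ hh, lintegral_Ioi_enorm_deriv_cutoffProfile_sq ha hab, mul_one]

end Cutoff

/-! ### Test functions and density in W₀^{1,1} -/

section TestFunctions

variable {N : ℕ} {Ω : Opens (EuclideanSpace ℝ (Fin N))}

theorem TestFunction.contDiff_one (φ : 𝓓(Ω, ℝ)) : ContDiff ℝ 1 φ :=
  φ.contDiff.of_le (by norm_cast)

theorem TestFunction.fderiv_eq_zero_of_notMem (φ : 𝓓(Ω, ℝ)) {x : EuclideanSpace ℝ (Fin N)}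
    (hx : x ∉ (Ω : Set (EuclideanSpace ℝ (Fin N)))) : fderiv ℝ φ x = 0 := by
  by_contra h
  exact hx (φ.tsupport_subset (support_fderiv_subset ℝ h))

theorem TestFunction.eq_zero_of_notMem (φ : 𝓓(Ω, ℝ)) {x : EuclideanSpace ℝ (Fin N)}
    (hx : x ∉ (Ω : Set (EuclideanSpace ℝ (Fin N)))) : φ x = 0 := by
  by_contra h
  exact hx (φ.tsupport_subset (subset_tsupport _ h))

theorem TestFunction.gradient_eq_zero_of_notMem (φ : 𝓓(Ω, ℝ)) {x : EuclideanSpace ℝ (Fin N)}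
    (hx : x ∉ (Ω : Set (EuclideanSpace ℝ (Fin N)))) : gradient φ x = 0 := by
  rw [← norm_eq_zero, norm_gradient_eq_norm_fderiv, φ.fderiv_eq_zero_of_notMem hx, norm_zero]

theorem TestFunction.hasCompactSupport_gradient (φ : 𝓓(Ω, ℝ)) :
    HasCompactSupport (gradient φ) := by
  have h := φ.hasCompactSupport.fderiv (𝕜 := ℝ)
  refine h.mono fun x hx hx' => hx ?_
  rw [← norm_eq_zero, norm_gradient_eq_norm_fderiv, norm_eq_zero]
  exact hx'

theorem TestFunction.setLIntegral_enorm_gradient (φ : 𝓓(Ω, ℝ)) :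
    ∫⁻ x in (Ω : Set (EuclideanSpace ℝ (Fin N))), ‖gradient φ x‖ₑ = ∫⁻ x, ‖gradient φ x‖ₑ := by
  rw [← lintegral_indicator Ω.isOpen.measurableSet]
  refine lintegral_congr fun x => ?_
  by_cases hx : x ∈ (Ω : Set (EuclideanSpace ℝ (Fin N)))
  · rw [indicator_of_mem hx]
  · rw [indicator_of_notMem hx, φ.gradient_eq_zero_of_notMem hx, enorm_zero]

/-- Excludes the quotient 0 / 0, which is 0 in `ℝ≥0∞`, from the infimum over nonzero test functions.
A function with zero gradient is constant, and compact support in a noncompact space makes that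
constant 0. -/
theorem TestFunction.lintegral_enorm_gradient_ne_zero [NeZero N] {φ : 𝓓(Ω, ℝ)} (hφ : φ ≠ 0) :
    ∫⁻ x, ‖gradient φ x‖ₑ ≠ 0 := by
  intro h
  have hcont : Continuous fun x => ‖gradient φ x‖ₑ := φ.contDiff_one.continuous_gradient.enorm
  have hz : (fun x => ‖gradient φ x‖ₑ) = 0 :=
    (hcont.ae_eq_iff_eq volume continuous_const).1 ((lintegral_eq_zero_iff hcont.measurable).1 h)
  have hfd : ∀ x, fderiv ℝ φ x = 0 := fun x => by
    have : ‖gradient φ x‖ₑ = 0 := congrFun hz x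
    rw [← norm_eq_zero, ← norm_gradient_eq_norm_fderiv, norm_eq_zero]
    simpa using this
  obtain ⟨y, hy⟩ : ∃ y, y ∉ tsupport φ := by
    by_contra! hall
    have hc : IsCompact (univ : Set (EuclideanSpace ℝ (Fin N))) := by
      rw [← eq_univ_of_forall hall]
      exact φ.hasCompactSupport
    exact noncompact_univ _ hc
  refine hφ (TestFunction.ext fun x => ?_)
  rw [is_const_of_fderiv_eq_zero (φ.contDiff_one.differentiable (by simp)) hfd x y]
  exact image_eq_zero_of_notMem_tsupport hy

theorem TestFunction.memSobolevZero (φ : 𝓓(Ω, ℝ)) : MemSobolevZero 1 Ω φ (gradient φ) where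
  memLp := (φ.continuous.memLp_of_hasCompactSupport φ.hasCompactSupport).restrict _
  memLp_grad := (φ.contDiff_one.continuous_gradient.memLp_of_hasCompactSupport
    φ.hasCompactSupport_gradient).restrict _
  isWeakGradient ψ v := by
    rw [setIntegral_eq_integral_of_forall_compl_eq_zero fun x hx => by
        rw [φ.eq_zero_of_notMem hx, zero_mul],
      setIntegral_eq_integral_of_forall_compl_eq_zero fun x hx => by
        rw [ψ.eq_zero_of_notMem hx, mul_zero]]
    have hin : ∀ x, inner ℝ (gradient φ x) v = fderiv ℝ φ x v := fun x => by
      rw [← toDual_gradient]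
      rfl
    simp only [hin]
    have hφ' : Continuous fun x => fderiv ℝ φ x v :=
      (φ.contDiff_one.continuous_fderiv (by simp)).clm_apply continuous_const
    have hψ' : Continuous fun x => fderiv ℝ ψ x v :=
      (ψ.contDiff_one.continuous_fderiv (by simp)).clm_apply continuous_const
    refine integral_mul_fderiv_eq_neg_fderiv_mul_of_integrable ?_ ?_ ?_
      (fun x _ => φ.contDiff_one.differentiable (by simp) x)
      (fun x _ => ψ.contDiff_one.differentiable (by simp) x)
    · exact (hφ'.mul ψ.continuous).integrable_of_hasCompactSupport ψ.hasCompactSupport.mul_left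
    · exact (φ.continuous.mul hψ').integrable_of_hasCompactSupport φ.hasCompactSupport.mul_right
    · exact (φ.continuous.mul ψ.continuous).integrable_of_hasCompactSupport
        φ.hasCompactSupport.mul_right
  mem_closure ε hε := ⟨φ, by simpa using hε⟩

/-- An `L¹` bound in terms of the gradient passes from `C_c^∞` to `W^{1,1}_0`. -/
theorem MemSobolevZero.lintegral_enorm_le {S : Set (EuclideanSpace ℝ (Fin N))} (hS : S ⊆ Ω)
    {K : ℝ≥0∞} (hK : K ≠ ⊤)
    (h : ∀ φ : 𝓓(Ω, ℝ), ∫⁻ x in S, ‖φ x‖ₑ ≤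
      K * ∫⁻ x in (Ω : Set (EuclideanSpace ℝ (Fin N))), ‖gradient φ x‖ₑ)
    {u : EuclideanSpace ℝ (Fin N) → ℝ} {G : EuclideanSpace ℝ (Fin N) → EuclideanSpace ℝ (Fin N)}
    (hu : MemSobolevZero 1 Ω u G) :
    ∫⁻ x in S, ‖u x‖ₑ ≤ K * ∫⁻ x in (Ω : Set (EuclideanSpace ℝ (Fin N))), ‖G x‖ₑ := by
  -- Replacing u by φ costs ε on the left, and replacing G by the gradient of φ costs K * ε on the
  -- right.
  have hle : ∀ ε : ℝ≥0∞, 0 < ε → ∫⁻ x in S, ‖u x‖ₑ ≤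
      K * (∫⁻ x in (Ω : Set (EuclideanSpace ℝ (Fin N))), ‖G x‖ₑ) + (1 + K) * ε := by
    intro ε hε
    obtain ⟨φ, hφ⟩ := hu.mem_closure ε hε
    simp only [eLpNorm_one_eq_lintegral_enorm] at hφ
    have hφm : Measurable fun x => ‖φ x‖ₑ := φ.continuous.enorm.measurable
    have h1 : ∫⁻ x in S, ‖u x‖ₑ ≤
        (∫⁻ x in (Ω : Set (EuclideanSpace ℝ (Fin N))), ‖u x - φ x‖ₑ) + ∫⁻ x in S, ‖φ x‖ₑ := by
      calc ∫⁻ x in S, ‖u x‖ₑ ≤ ∫⁻ x in S, (‖u x - φ x‖ₑ + ‖φ x‖ₑ) :=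
            lintegral_mono fun x => by simpa using enorm_add_le (u x - φ x) (φ x)
        _ = (∫⁻ x in S, ‖u x - φ x‖ₑ) + ∫⁻ x in S, ‖φ x‖ₑ := lintegral_add_right _ hφm
        _ ≤ _ := by gcongr
    have h2 : ∫⁻ x in (Ω : Set (EuclideanSpace ℝ (Fin N))), ‖gradient φ x‖ₑ ≤
        (∫⁻ x in (Ω : Set (EuclideanSpace ℝ (Fin N))), ‖G x‖ₑ) +
          ∫⁻ x in (Ω : Set (EuclideanSpace ℝ (Fin N))), ‖G x - gradient φ x‖ₑ := by
      rw [← lintegral_add_left' hu.memLp_grad.1.enorm]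
      refine lintegral_mono fun x => ?_
      simpa using enorm_sub_le (E := EuclideanSpace ℝ (Fin N)) (a := G x) (b := G x - gradient φ x)
    calc ∫⁻ x in S, ‖u x‖ₑ ≤ ε + K * ((∫⁻ x in (Ω : Set (EuclideanSpace ℝ (Fin N))), ‖G x‖ₑ) + ε) :=
          h1.trans (add_le_add (le_self_add.trans hφ.le) ((h φ).trans (mul_le_mul' le_rfl
            (h2.trans (add_le_add le_rfl (le_add_self.trans hφ.le))))))
      _ = _ := by ring
  have hlim : Filter.Tendsto (fun ε : ℝ≥0∞ =>
      K * (∫⁻ x in (Ω : Set (EuclideanSpace ℝ (Fin N))), ‖G x‖ₑ) + (1 + K) * ε)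
      (nhdsWithin 0 (Ioi 0))
      (nhds (K * (∫⁻ x in (Ω : Set (EuclideanSpace ℝ (Fin N))), ‖G x‖ₑ) + (1 + K) * 0)) :=
    (tendsto_const_nhds.add (ENNReal.Tendsto.const_mul Filter.tendsto_id
      (Or.inr (by finiteness)))).mono_left nhdsWithin_le_nhds
  simpa using ge_of_tendsto hlim (eventually_nhdsWithin_of_forall fun ε hε => hle ε hε)

end TestFunctions

/-! ### Balls as competitors -/

section Ball

variable {N : ℕ}

theorem isOpenSmoothBoundary_ball {r : ℝ} (hr : 0 < r) :
    IsOpenSmoothBoundary (Metric.ball (0 : EuclideanSpace ℝ (Fin N)) r) := by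
  refine ⟨Metric.isOpen_ball, fun x hx => ⟨univ, isOpen_univ, mem_univ x,
    fun y => ‖y‖ ^ 2 - r ^ 2, ((contDiff_norm_sq ℝ).sub contDiff_const).contDiffOn, ?_, ?_, ?_⟩⟩
  · rw [frontier_ball _ hr.ne'] at hx
    simp [mem_sphere_zero_iff_norm.1 hx]
  · rw [frontier_ball _ hr.ne'] at hx
    have hxr : ‖x‖ = r := mem_sphere_zero_iff_norm.1 hx
    rw [((hasStrictFDerivAt_norm_sq x).hasFDerivAt.sub_const (r ^ 2)).fderiv]
    intro h
    have := DFunLike.congr_fun h x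
    simp [hxr, hr.ne'] at this
  · ext y
    simp [sq_lt_sq₀ (norm_nonneg y) hr.le]

theorem isCheegerAdmissible_ball {r R : ℝ} (hr : 0 < r) (hrR : r < R) :
    IsCheegerAdmissible (centredBall N R) (Metric.ball 0 r) := by
  have hsub := Metric.closure_ball_subset_closedBall (x := (0 : EuclideanSpace ℝ (Fin N))) (ε := r)
  exact ⟨isOpenSmoothBoundary_ball hr,
    (isCompact_closedBall _ _).of_isClosed_subset isClosed_closure hsub,
    hsub.trans (Metric.closedBall_subset_ball hrR)⟩

/-- A radial cutoff as a test function. -/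
noncomputable def radialCutoff (N : ℕ) {a b R : ℝ} (ha : 0 ≤ a) (hab : a < b) (hbR : b < R) :
    𝓓(centredBall N R, ℝ) where
  toFun x := cutoffProfile a b (‖x‖ ^ 2)
  contDiff' := (contDiff_cutoffProfile a b).comp (contDiff_norm_sq ℝ)
  hasCompactSupport' := hasCompactSupport_cutoffProfile_norm_sq ha hab
  tsupport_subset' := (tsupport_cutoffProfile_norm_sq_subset ha hab).trans
    (Metric.closedBall_subset_ball hbR)

/-- Cutoffs between radii r and b are competitors, and b decreases to r. -/
theorem relCapacity_closedBall_le {n : ℕ} {r R : ℝ} (hr : 0 < r) (hrR : r < R) :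
    relCapacity 1 (Metric.closedBall 0 r) (centredBall (n + 1) R) ≤
      μHE[n] (Metric.sphere (0 : EuclideanSpace ℝ (Fin (n + 1))) r) := by
  have hn : Module.finrank ℝ (EuclideanSpace ℝ (Fin (n + 1))) = n + 1 := by simp
  rw [euclideanHausdorffMeasure_sphere hn hr]
  have hle : ∀ b ∈ Ioo r R, relCapacity 1 (Metric.closedBall 0 r) (centredBall (n + 1) R) ≤
      ENNReal.ofReal (b ^ n) *
        (volume : Measure (EuclideanSpace ℝ (Fin (n + 1)))).toSphere univ := by
    rintro b ⟨hrb, hbR⟩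
    refine (iInf₂_le (radialCutoff (n + 1) hr.le hrb hbR) fun x hx => ?_).trans ?_
    · refine (cutoffProfile_eq_one hr.le hrb ?_).ge
      have : ‖x‖ ≤ r := by simpa using hx
      gcongr
    · simp only [ENNReal.rpow_one]
      rw [TestFunction.setLIntegral_enorm_gradient]
      exact lintegral_enorm_gradient_cutoff_le hn hr.le hrb
  have hlim : Filter.Tendsto (fun b : ℝ => ENNReal.ofReal (b ^ n) *
      (volume : Measure (EuclideanSpace ℝ (Fin (n + 1)))).toSphere univ)
      (nhdsWithin r (Ioi r)) (nhds (ENNReal.ofReal (r ^ n) *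
        (volume : Measure (EuclideanSpace ℝ (Fin (n + 1)))).toSphere univ)) :=
    (ENNReal.Tendsto.mul_const ((ENNReal.continuous_ofReal.comp (continuous_pow n)).tendsto r)
      (Or.inr (measure_ne_top _ _))).mono_left nhdsWithin_le_nhds
  refine ge_of_tendsto hlim ?_
  filter_upwards [Ioo_mem_nhdsGT hrR] with b hb using hle b hb

end Ball

/-! ### The main theorem -/

theorem mainTheorem6 (N : ℕ) (hN : 2 ≤ N) (r₁ r₂ R : ℝ) (hr₁ : 0 < r₁) (hr₁₂ : r₁ < r₂)
    (hr₂R : r₂ < R) :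
    -- the sharp constant
    sharpConstant (centredBall N R) (shell N r₁ r₂) =
        volume (shell N r₁ r₂) /
          relCapacity 1 (Metric.closedBall 0 r₂) (centredBall N R) ∧
      volume (shell N r₁ r₂) / relCapacity 1 (Metric.closedBall 0 r₂) (centredBall N R) =
        volume (shell N r₁ r₂) /
          μHE[N - 1] (frontier (Metric.ball (0 : EuclideanSpace ℝ (Fin N)) r₂)) ∧
      -- the associated Cheeger-type constant
      (⨅ (φ : 𝓓(centredBall N R, ℝ)) (_ : φ ≠ 0),
          (∫⁻ x in (centredBall N R : Set (EuclideanSpace ℝ (Fin N))), ‖gradient φ x‖ₑ) /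
            ∫⁻ x in shell N r₁ r₂, ‖φ x‖ₑ) =
        cheegerConstant (centredBall N R) (shell N r₁ r₂) ∧
      cheegerConstant (centredBall N R) (shell N r₁ r₂) =
        relCapacity 1 (Metric.closedBall 0 r₂) (centredBall N R) / volume (shell N r₁ r₂) ∧
      cheegerConstant (centredBall N R) (shell N r₁ r₂) =
        μHE[N - 1] (frontier (Metric.ball (0 : EuclideanSpace ℝ (Fin N)) r₂)) /
          volume (shell N r₁ r₂) ∧
      -- the ball of radius `r₂` is admissible and optimal
      IsCheegerAdmissible (centredBall N R) (Metric.ball 0 r₂) ∧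
      cheegerRatio (shell N r₁ r₂) (Metric.ball 0 r₂) =
        cheegerConstant (centredBall N R) (shell N r₁ r₂) := by
  obtain ⟨n, rfl⟩ : ∃ n, N = n + 1 := ⟨N - 1, by omega⟩
  have hr₂ : 0 < r₂ := hr₁.trans hr₁₂
  have hn : Module.finrank ℝ (EuclideanSpace ℝ (Fin (n + 1))) = n + 1 := by simp
  rw [Nat.add_sub_cancel, frontier_ball _ hr₂.ne']
  set Ω := centredBall (n + 1) R with hΩ
  set S := shell (n + 1) r₁ r₂ with hS
  set P := μHE[n] (Metric.sphere (0 : EuclideanSpace ℝ (Fin (n + 1))) r₂) with hP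
  set K := ENNReal.ofReal ((r₂ ^ (n + 1) - r₁ ^ (n + 1)) / ((n + 1) * r₂ ^ n)) with hKdef
  have hPeq := euclideanHausdorffMeasure_sphere hn hr₂
  have hK0 : K ≠ 0 := by
    have h12 : r₁ ^ (n + 1) < r₂ ^ (n + 1) := pow_lt_pow_left₀ hr₁₂ hr₁.le (by simp)
    simpa [hKdef] using div_pos (sub_pos.2 h12) (by positivity)
  have hKt : K ≠ ⊤ := ENNReal.ofReal_ne_top
  have hP0 : P ≠ 0 := by
    rw [hP, hPeq]
    refine mul_ne_zero (by simp; positivity) ?_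
    rw [Measure.measure_univ_ne_zero]
    exact Measure.toSphere_ne_zero _
  have hPt : P ≠ ⊤ := by
    rw [hP, hPeq]
    exact ENNReal.mul_ne_top ENNReal.ofReal_ne_top (measure_ne_top _ _)
  have hSvol : volume S = K * P := by rw [hP, hPeq]; exact volume_shell hn hr₁ hr₁₂
  have hS0 : volume S ≠ 0 := by rw [hSvol]; exact mul_ne_zero hK0 hP0
  have hSt : volume S ≠ ⊤ := by rw [hSvol]; exact ENNReal.mul_ne_top hKt hPt
  have hSball : S ⊆ Metric.ball 0 r₂ := sdiff_subset
  have hSΩ : S ⊆ Ω := hSball.trans (Metric.ball_subset_ball hr₂R.le)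
  have hSm : MeasurableSet S := measurableSet_ball.diff measurableSet_closedBall
  have hineq : ∀ φ : 𝓓(Ω, ℝ), ∫⁻ x in S, ‖φ x‖ₑ ≤
      K * ∫⁻ x in (Ω : Set (EuclideanSpace ℝ (Fin (n + 1)))), ‖gradient φ x‖ₑ := fun φ => by
    rw [φ.setLIntegral_enorm_gradient]
    exact lintegral_shell_enorm_le hn hr₁ hr₁₂ φ.contDiff_one φ.hasCompactSupport
  have hadm : ∀ φ : 𝓓(Ω, ℝ), (∀ x ∈ Metric.closedBall 0 r₂, 1 ≤ φ x) →
      volume S ≤ ∫⁻ x in S, ‖φ x‖ₑ := fun φ hφ => by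
    rw [← setLIntegral_one]
    refine setLIntegral_mono' hSm fun x hx => ?_
    have h1 : 1 ≤ φ x := hφ x (Metric.ball_subset_closedBall (hSball hx))
    rw [Real.enorm_of_nonneg (by linarith)]
    exact ENNReal.one_le_ofReal.2 h1
  -- A competitor is at least 1 on S, so K * P = |S| ≤ ∫_S |φ| ≤ K ∫ |∇φ|, and K cancels.
  have hcap : relCapacity 1 (Metric.closedBall 0 r₂) Ω = P := by
    refine le_antisymm (relCapacity_closedBall_le hr₂ hr₂R) (le_iInf₂ fun φ hφ => ?_)
    simp only [ENNReal.rpow_one]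
    have := (hadm φ hφ).trans (hineq φ)
    rw [hSvol] at this
    exact (ENNReal.mul_le_mul_iff_right hK0 hKt).1 this
  have hSP : volume S / P = K := by rw [hSvol, ENNReal.mul_div_cancel_right hP0 hPt]
  have hPS : P / volume S = K⁻¹ := by
    rw [← hSP, ENNReal.inv_div (Or.inl hPt) (Or.inl hP0)]
  have hne : ∀ φ : 𝓓(Ω, ℝ), (∀ x ∈ Metric.closedBall 0 r₂, 1 ≤ φ x) →
      ∫⁻ x in S, ‖φ x‖ₑ ≠ 0 := fun φ hφ h => hS0 (le_zero_iff.1 (h ▸ hadm φ hφ))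
  have hfin : ∀ φ : 𝓓(Ω, ℝ),
      ∫⁻ x in (Ω : Set (EuclideanSpace ℝ (Fin (n + 1)))), ‖gradient φ x‖ₑ ≠ ⊤ := fun φ => by
    have := φ.memSobolevZero.memLp_grad.2
    rw [eLpNorm_one_eq_lintegral_enorm] at this
    exact this.ne
  have hsharp : sharpConstant Ω S = K := by
    have hle : sharpConstant Ω S ≤ K :=
      iSup_le fun u => iSup_le fun G => iSup_le fun hu => iSup_le fun _ =>
        ENNReal.div_le_of_le_mul (hu.lintegral_enorm_le hSΩ hKt hineq)
    refine le_antisymm hle ?_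
    -- Each capacity competitor is a nonzero element of W₀^{1,1} with ∫_S |φ| ≥ |S|. The inequality
    -- is rearranged into a lower bound for the capacity so that it can be checked on each
    -- competitor.
    rw [← hSP]
    refine ENNReal.div_le_of_le_mul ?_
    rw [mul_comm, ← ENNReal.div_le_iff_le_mul (Or.inr hPt) (Or.inr hP0), ← hcap]
    refine le_iInf₂ fun φ hφ => ENNReal.div_le_of_le_mul ((hadm φ hφ).trans ?_)
    simp only [ENNReal.rpow_one]
    have hgrad : ∫⁻ x in (Ω : Set (EuclideanSpace ℝ (Fin (n + 1)))), ‖gradient φ x‖ₑ ≠ 0 :=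
      fun h => hne φ hφ (le_zero_iff.1 (by simpa [h] using hineq φ))
    rw [mul_comm, ← ENNReal.div_le_iff_le_mul (Or.inl hgrad) (Or.inl (hfin φ))]
    refine le_iSup_of_le (φ : EuclideanSpace ℝ (Fin (n + 1)) → ℝ) (le_iSup_of_le (gradient φ)
      (le_iSup_of_le φ.memSobolevZero (le_iSup_of_le (fun h => hne φ hφ ?_) le_rfl)))
    rw [lintegral_eq_zero_iff φ.continuous.enorm.measurable]
    filter_upwards [ae_restrict_of_ae_restrict_of_subset hSΩ h] with x hx
    simp [hx]
  have hcheeger : cheegerConstant Ω S = K⁻¹ := by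
    refine le_antisymm ?_ (le_iInf₂ fun U hU => ?_)
    · refine (iInf₂_le _ (isCheegerAdmissible_ball hr₂ hr₂R)).trans_eq ?_
      rw [cheegerRatio, inter_eq_right.2 hSball, if_neg hS0, Nat.add_sub_cancel,
        frontier_ball _ hr₂.ne', hPS]
    · rw [cheegerRatio]
      split_ifs with h0
      · exact le_top
      · rw [Nat.add_sub_cancel]
        have h := volume_inter_shell_le hn hr₁ hr₁₂ hU.1.1
          (hU.2.1.isBounded.subset subset_closure)
        have hfin : volume (U ∩ S) ≠ ⊤ :=
          ((measure_mono inter_subset_right).trans_lt hSt.lt_top).ne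
        rw [ENNReal.le_div_iff_mul_le (Or.inl h0) (Or.inl hfin)]
        calc K⁻¹ * volume (U ∩ S) ≤ K⁻¹ * (K * μHE[n] (frontier U)) := mul_le_mul' le_rfl h
          _ = μHE[n] (frontier U) := by rw [← mul_assoc, ENNReal.inv_mul_cancel hK0 hKt, one_mul]
  refine ⟨by rw [hsharp, hcap, hSP], by rw [hcap], ?_, by rw [hcheeger, hcap, hPS],
    by rw [hcheeger, hPS], isCheegerAdmissible_ball hr₂ hr₂R, ?_⟩
  · rw [hcheeger]
    refine le_antisymm ?_ (le_iInf₂ fun φ hφ => ?_)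
    · rw [← hPS, ← hcap]
      rw [ENNReal.le_div_iff_mul_le (Or.inl hS0) (Or.inl hSt)]
      refine le_iInf₂ fun φ hφ => ENNReal.mul_le_of_le_div ?_
      simp only [ENNReal.rpow_one]
      have hφ0 : φ ≠ 0 := fun h => hne φ hφ (by simp [h])
      exact (iInf₂_le φ hφ0).trans (ENNReal.div_le_div_left (hadm φ hφ) _)
    -- A nonzero numerator makes the quotient +∞ when φ vanishes on S, so that case needs no
    -- separate treatment.
    · have h0 : ∫⁻ x in (Ω : Set (EuclideanSpace ℝ (Fin (n + 1)))), ‖gradient φ x‖ₑ ≠ 0 := by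
        rw [φ.setLIntegral_enorm_gradient]
        exact TestFunction.lintegral_enorm_gradient_ne_zero hφ
      rw [ENNReal.le_div_iff_mul_le (Or.inr h0) (Or.inr (hfin φ))]
      refine (mul_le_mul' le_rfl (hineq φ)).trans_eq ?_
      rw [← mul_assoc, ENNReal.inv_mul_cancel hK0 hKt, one_mul]
  · rw [hcheeger, cheegerRatio, inter_eq_right.2 hSball, if_neg hS0, Nat.add_sub_cancel,
      frontier_ball _ hr₂.ne', hPS]
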